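/- All Banach spaces are real. A normalized basic sequence $(x_i)_{i\ge1}$ in a Banach space $X$ (a sequence of norm-one vectors that is a Schauder basis of its closed linear span) generates the spreading model $(\tilde x_i)_{i\ge 1}$, where $(\tilde x_i)$ is the unit vector basis of $c_{00}$ under some norm on $c_{00}$, if for some sequence $\varepsilon_n\downarrow 0$ we have, for all $n\in\mathbb N$, all $(a_i)_{i=1}^n\subseteq[-1,1]$ and all $n\le k_1<\dots<k_n$, $$(1+\varepsilon_n)^{-1}\Big\|\sum_{i=1}^n a_i\tilde x_i\Big\|\le\Big\|\sum_{i=1}^n a_i x_{k_i}\Big\|\le(1+\varepsilon_n)\Big\|\sum_{i=1}^n a_i\tilde x_i\Big\|.$$ For two spreading models write $(\tilde x_i)\le(\tilde y_i)$ if there is $C<\infty$ with $\|\sum a_i\tilde x_i\|\le C\|\sum a_i\tilde y_i\|$ for all finitely supported real sequences $(a_i)$, and call them equivalent if each is $\le$ the other. Let $SP_w(X)$ be the set of equivalence classes of spreading models generated by weakly null normalized basic sequences in $X$, partially ordered by the order induced by $\le$. **Theorem.** For every nonempty finite lattice $L$ there is a separable, infinite-dimensional, reflexive Banach space $X_L$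 such that $(SP_w(X_L),\le)$ is order-isomorphic to $L$. -/

import Mathlib

open Filter Topology

/-- A real normed space is reflexive if the canonical embedding into its bidual is onto. -/
def IsReflexiveSpace (X : Type*) [NormedAddCommGroup X] [NormedSpace ℝ X] : Prop :=
  Function.Surjective (NormedSpace.inclusionInDoubleDual ℝ X)

/-- `x` is a basic sequence: a Schauder basis of its closed linear span. -/
def IsBasicSequence {X : Type*} [NormedAddCommGroup X] [NormedSpace ℝ X] (x : ℕ → X) : Prop :=
  ∃ b : SchauderBasis ℝ (Submodule.span ℝ (Set.range x)).topologicalClosure,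
    ∀ i, ((b i : (Submodule.span ℝ (Set.range x)).topologicalClosure) : X) = x i

/-- `x` converges weakly to `0`. -/
def IsWeaklyNull {X : Type*} [NormedAddCommGroup X] [NormedSpace ℝ X] (x : ℕ → X) : Prop :=
  ∀ f : StrongDual ℝ X, Tendsto (fun n => f (x n)) atTop (𝓝 0)

/-- `x` is a normalized basic sequence that generates the spreading model `N`. The spreading model
is recorded as the norm it induces on `c₀₀ = ℕ →₀ ℝ`, that is,
`N a = ‖∑ i, a i • x̃ i‖`; so `x̃` is the unit vector basis of `(c₀₀, N)`.

Sequences are indexed from `0` here, so the `j`-th index is the `(j + 1)`-st position, and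
the positions `k i + 1` of the chosen vectors satisfy `n ≤ k₁ + 1 < ⋯ < kₙ + 1`. -/
def GeneratesSpreadingModel {X : Type*} [NormedAddCommGroup X] [NormedSpace ℝ X]
    (x : ℕ → X) (N : Seminorm ℝ (ℕ →₀ ℝ)) : Prop :=
  (∀ i, ‖x i‖ = 1) ∧ IsBasicSequence x ∧ (∀ a, N a = 0 → a = 0) ∧
    ∃ ε : ℕ → ℝ, Antitone ε ∧ Tendsto ε atTop (𝓝 0) ∧
      ∀ (n : ℕ) (a : Fin n → ℝ), (∀ i, a i ∈ Set.Icc (-1 : ℝ) 1) →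
        ∀ k : Fin n → ℕ, StrictMono k → (∀ i, n ≤ k i + 1) →
          (1 + ε n)⁻¹ * N (∑ i : Fin n, Finsupp.single (i : ℕ) (a i)) ≤ ‖∑ i, a i • x (k i)‖ ∧
          ‖∑ i, a i • x (k i)‖ ≤ (1 + ε n) * N (∑ i : Fin n, Finsupp.single (i : ℕ) (a i))

/-- The spreading models of `X` that are generated by weakly null (normalized basic) sequences. -/
structure WeakSpreadingModel (X : Type*) [NormedAddCommGroup X] [NormedSpace ℝ X] where
  /-- the norm on `c₀₀` -/
  toSeminorm : Seminorm ℝ (ℕ →₀ ℝ)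
  /-- a weakly null sequence of `X` generates it -/
  generated : ∃ x : ℕ → X, IsWeaklyNull x ∧ GeneratesSpreadingModel x toSeminorm

/-- Domination: `x̃ ≤ ỹ` if, for some `C < ∞`, `ỹ` `C`-dominates `x̃`. -/
instance WeakSpreadingModel.instPreorder (X : Type*) [NormedAddCommGroup X] [NormedSpace ℝ X] :
    Preorder (WeakSpreadingModel X) where
  le M M' := ∃ C : ℝ, ∀ a : ℕ →₀ ℝ, M.toSeminorm a ≤ C * M'.toSeminorm a
  le_refl M := ⟨1, fun a => by rw [one_mul]⟩
  le_trans M₁ M₂ M₃ := by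
    rintro ⟨C, hC⟩ ⟨D, hD⟩
    refine ⟨|C| * D, fun a => (hC a).trans ?_⟩
    calc C * M₂.toSeminorm a ≤ |C| * M₂.toSeminorm a :=
          mul_le_mul_of_nonneg_right (le_abs_self C) (apply_nonneg M₂.toSeminorm a)
      _ ≤ |C| * (D * M₃.toSeminorm a) := mul_le_mul_of_nonneg_left (hD a) (abs_nonneg C)
      _ = |C| * D * M₃.toSeminorm a := (mul_assoc _ _ _).symm

/-- `SP_w(X)`: the weakly null spreading models of `X` modulo equivalence (each dominates the
other), with the partial order induced by domination. -/
abbrev SPw (X : Type*) [NormedAddCommGroup X] [NormedSpace ℝ X] : Type :=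
  Antisymmetrization (WeakSpreadingModel X) (· ≤ ·)

/-- Minkowski's inequality for finite `ℓ₂` sums of nonnegative reals, as a pointwise bound. -/
theorem sqrt_sum_sq_le_add {ι : Type*} (s : Finset ι) {f g h : ι → ℝ}
    (hf : ∀ i ∈ s, 0 ≤ f i) (hg : ∀ i ∈ s, 0 ≤ g i) (hh : ∀ i ∈ s, 0 ≤ h i)
    (H : ∀ i ∈ s, f i ≤ g i + h i) :
    √(∑ i ∈ s, f i ^ 2) ≤ √(∑ i ∈ s, g i ^ 2) + √(∑ i ∈ s, h i ^ 2) := by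
  have key := Real.Lp_add_le_of_nonneg s (p := 2) (by norm_num) hg hh
  simp only [Real.rpow_two, ← Real.sqrt_eq_rpow] at key
  refine (Real.sqrt_le_sqrt (Finset.sum_le_sum fun i hi => ?_)).trans key
  exact pow_le_pow_left₀ (hf i hi) (H i hi) 2

/-- Restriction of a sequence to a finite set of coordinates. -/
noncomputable def restr (x : ℕ → ℝ) (E : Finset ℕ) : ℕ →₀ ℝ :=
  Finsupp.onFinset E (fun i => if i ∈ E then x i else 0) fun i hi => by
    by_contra h
    exact hi (if_neg h)

theorem restr_apply (x : ℕ → ℝ) (E : Finset ℕ) (i : ℕ) :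
    restr x E i = if i ∈ E then x i else 0 := rfl

theorem restr_apply_mem {x : ℕ → ℝ} {E : Finset ℕ} {i : ℕ} (h : i ∈ E) : restr x E i = x i :=
  if_pos h

theorem restr_add (x y : ℕ → ℝ) (E : Finset ℕ) : restr (x + y) E = restr x E + restr y E := by
  ext i
  simp only [restr_apply, Finsupp.add_apply, Pi.add_apply]
  split_ifs <;> simp

theorem restr_smul (t : ℝ) (x : ℕ → ℝ) (E : Finset ℕ) : restr (t • x) E = t • restr x E := by
  ext i
  simp [restr_apply]

theorem restr_zero (E : Finset ℕ) : restr 0 E = 0 := by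
  ext i
  simp [restr_apply]

theorem restr_empty (x : ℕ → ℝ) : restr x ∅ = 0 := by
  ext i
  simp [restr_apply]

theorem support_restr_subset (x : ℕ → ℝ) (E : Finset ℕ) : (restr x E).support ⊆ E :=
  Finsupp.support_onFinset_subset

theorem restr_congr {x y : ℕ → ℝ} {E : Finset ℕ} (h : ∀ i ∈ E, x i = y i) :
    restr x E = restr y E := by
  ext i
  simp only [restr_apply]
  split_ifs with hi
  exacts [h i hi, rfl]

theorem restr_of_support_subset {c : ℕ →₀ ℝ} {E : Finset ℕ} (h : c.support ⊆ E) :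
    restr c E = c := by
  ext i
  rw [restr_apply]
  split_ifs with hi
  · rfl
  · exact (Finsupp.notMem_support_iff.mp fun h' => hi (h h')).symm

theorem restr_eq_sum (x : ℕ → ℝ) (E : Finset ℕ) :
    restr x E = ∑ i ∈ E, Finsupp.single i (x i) := by
  ext i
  rw [restr_apply, Finsupp.finsetSum_apply]
  simp [Finsupp.single_apply]

theorem restr_union {x : ℕ → ℝ} {E F : Finset ℕ} (h : Disjoint E F) :
    restr x (E ∪ F) = restr x E + restr x F := by
  simp only [restr_eq_sum, Finset.sum_union h]

/-- A symmetric lattice norm on finitely supported sequences which satisfies a lower `2`-estimate,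
is submultiplicative for tensor products, and has `‖e₁ + ⋯ + eₙ‖ = o(n)`. -/
structure TensorNorm extends Seminorm ℝ (ℕ →₀ ℝ) where
  dominated : ∀ (c a : ℕ →₀ ℝ) (σ : ℕ → ℕ), Set.InjOn σ c.support →
    (∀ p, |c p| ≤ |a (σ p)|) → toSeminorm c ≤ toSeminorm a
  lower : ∀ a b : ℕ →₀ ℝ, Disjoint a.support b.support →
    toSeminorm a ^ 2 + toSeminorm b ^ 2 ≤ toSeminorm (a + b) ^ 2
  tensor : ∀ (c a b : ℕ →₀ ℝ) (σ τ : ℕ → ℕ), Set.InjOn (fun p => (σ p, τ p)) c.support →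
    (∀ p, |c p| ≤ |a (σ p)| * |b (τ p)|) → toSeminorm c ≤ toSeminorm a * toSeminorm b
  one_le : 1 ≤ toSeminorm (Finsupp.single 0 1)
  average : Tendsto (fun n : ℕ => toSeminorm (restr 1 (Finset.range n)) / n) atTop (𝓝 0)

namespace TensorNorm

noncomputable instance : CoeFun TensorNorm fun _ => (ℕ →₀ ℝ) → ℝ := ⟨fun N => N.toSeminorm⟩

variable (N : TensorNorm)

theorem nonneg (c : ℕ →₀ ℝ) : 0 ≤ N c := apply_nonneg N.toSeminorm c

theorem add_le (a b : ℕ →₀ ℝ) : N (a + b) ≤ N a + N b := map_add_le_add N.toSeminorm a b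

theorem smul_eq (t : ℝ) (a : ℕ →₀ ℝ) : N (t • a) = |t| * N a := map_smul_eq_mul N.toSeminorm t a

theorem zero_eq : N (0 : ℕ →₀ ℝ) = 0 := map_zero N.toSeminorm

theorem mono {c a : ℕ →₀ ℝ} (h : ∀ p, |c p| ≤ |a p|) : N c ≤ N a :=
  N.dominated c a id (Set.injOn_id _) h

/-- The norm of a unit vector. -/
noncomputable def unit : ℝ := N (Finsupp.single 0 1)

theorem unit_pos : 0 < N.unit := zero_lt_one.trans_le N.one_le

theorem single_one (p : ℕ) : N (Finsupp.single p 1) = N.unit := by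
  refine le_antisymm ?_ ?_
  · refine N.dominated _ _ (fun q => if q = p then 0 else q + 1)
      (fun q hq r hr h => ?_) fun q => ?_
    · have h1 : q = p := by simpa [Finsupp.single_apply, eq_comm] using hq
      have h2 : r = p := by simpa [Finsupp.single_apply, eq_comm] using hr
      rw [h1, h2]
    · by_cases hq : q = p
      · simp [hq]
      · simp [Finsupp.single_apply, Ne.symm hq]
  · refine N.dominated _ _ (fun q => q + p) (fun q _ r _ h => by simpa using h) fun q => ?_
    by_cases hq : q = 0
    · simp [hq]
    · simp [Finsupp.single_apply, Ne.symm hq]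

theorem single_eq (p : ℕ) (t : ℝ) : N (Finsupp.single p t) = N.unit * |t| := by
  have : (Finsupp.single p t : ℕ →₀ ℝ) = t • Finsupp.single p 1 := by simp
  rw [this, N.smul_eq, single_one, mul_comm]

theorem restr_le_sum (x : ℕ → ℝ) (E : Finset ℕ) : N (restr x E) ≤ N.unit * ∑ p ∈ E, |x p| := by
  rw [restr_eq_sum, Finset.mul_sum]
  refine (map_sum_le_sum_map N.toSeminorm _ _).trans (le_of_eq ?_)
  exact Finset.sum_congr rfl fun p _ => N.single_eq p (x p)
where
  map_sum_le_sum_map (q : Seminorm ℝ (ℕ →₀ ℝ)) (E : Finset ℕ) (f : ℕ → ℕ →₀ ℝ) :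
      q (∑ i ∈ E, f i) ≤ ∑ i ∈ E, q (f i) := by
    classical
    induction E using Finset.induction_on with
    | empty => simp
    | insert i E hi ih =>
      rw [Finset.sum_insert hi, Finset.sum_insert hi]
      exact (map_add_le_add q _ _).trans (by gcongr)

theorem restr_mono {x y : ℕ → ℝ} {E F : Finset ℕ} (hEF : E ⊆ F) (h : ∀ p ∈ E, |x p| ≤ |y p|) :
    N (restr x E) ≤ N (restr y F) := by
  refine N.mono fun p => ?_
  by_cases hp : p ∈ E
  · rw [restr_apply_mem hp, restr_apply_mem (hEF hp)]
    exact h p hp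
  · rw [restr_apply, if_neg hp, abs_zero]
    exact abs_nonneg _

theorem abs_le_restr (x : ℕ → ℝ) {E : Finset ℕ} {p : ℕ} (hp : p ∈ E) : |x p| ≤ N (restr x E) := by
  calc |x p| ≤ N.unit * |x p| := le_mul_of_one_le_left (abs_nonneg _) N.one_le
    _ = N (restr x {p}) := by rw [restr_eq_sum, Finset.sum_singleton, N.single_eq]
    _ ≤ _ := N.restr_mono (by simpa using hp) fun _ _ => le_rfl

/-- The lower `2`-estimate for finitely many disjoint sets. -/
theorem sum_sq_restr_le (x : ℕ → ℝ) (𝓔 : Finset (Finset ℕ))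
    (h : (𝓔 : Set (Finset ℕ)).PairwiseDisjoint id) :
    ∑ E ∈ 𝓔, N (restr x E) ^ 2 ≤ N (restr x (𝓔.biUnion id)) ^ 2 := by
  classical
  induction 𝓔 using Finset.induction_on with
  | empty => simp
  | insert E 𝓔 hE ih =>
    rw [Finset.coe_insert, Set.pairwiseDisjoint_insert_of_notMem (by simpa using hE)] at h
    have hd : Disjoint E (𝓔.biUnion id) := by
      rw [Finset.disjoint_biUnion_right]
      exact fun F hF => h.2 F hF
    rw [Finset.sum_insert hE, Finset.biUnion_insert, id, restr_union hd]
    refine (add_le_add le_rfl (ih h.1)).trans (N.lower _ _ ?_)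
    exact Finset.disjoint_of_subset_left (support_restr_subset _ _)
      (Finset.disjoint_of_subset_right (support_restr_subset _ _) hd)

theorem sum_sq_le (x : ℕ → ℝ) (E : Finset ℕ) : ∑ p ∈ E, x p ^ 2 ≤ N (restr x E) ^ 2 := by
  classical
  have h := N.sum_sq_restr_le x (E.image singleton) ?_
  · rw [Finset.sum_image (by simp)] at h
    have hE : (E.image singleton).biUnion id = E := by
      ext p
      simp
    rw [hE] at h
    refine (Finset.sum_le_sum fun p _ => ?_).trans h
    rw [← sq_abs]
    exact pow_le_pow_left₀ (abs_nonneg _) (N.abs_le_restr x (Finset.mem_singleton_self p)) 2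
  · intro A hA B hB hAB
    obtain ⟨p, -, rfl⟩ : ∃ p ∈ E, {p} = A := by simpa using hA
    obtain ⟨q, -, rfl⟩ : ∃ q ∈ E, {q} = B := by simpa using hB
    exact Finset.disjoint_singleton.mpr fun h => hAB (by rw [h])

theorem eq_zero_of_eq_zero {c : ℕ →₀ ℝ} (h : N c = 0) : c = 0 := by
  ext p
  by_cases hp : p ∈ c.support
  · have := N.abs_le_restr c hp
    rw [restr_of_support_subset (Finset.Subset.refl _), h] at this
    simpa using abs_nonpos_iff.mp this
  · simpa using hp

end TensorNorm

namespace TensorNorm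

/-- The `ℓ₂`-sum of two norms. -/
noncomputable def hilbertSum (N₁ N₂ : TensorNorm) : TensorNorm where
  toSeminorm := Seminorm.of (fun c => √(N₁ c ^ 2 + N₂ c ^ 2))
    (fun a b => by
      have h := sqrt_sum_sq_le_add (Finset.univ : Finset Bool)
        (f := fun i => bif i then N₁ (a + b) else N₂ (a + b))
        (g := fun i => bif i then N₁ a else N₂ a) (h := fun i => bif i then N₁ b else N₂ b)
        (by simp) (by simp) (by simp) (by simp [add_le])
      simpa using h)
    (fun t a => by
      simp only [smul_eq, mul_pow, ← mul_add]
      rw [Real.sqrt_mul (by positivity), Real.sqrt_sq (abs_nonneg t), Real.norm_eq_abs])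
  dominated c a σ hσ h := Real.sqrt_le_sqrt (add_le_add
    (pow_le_pow_left₀ (N₁.nonneg _) (N₁.dominated c a σ hσ h) 2)
    (pow_le_pow_left₀ (N₂.nonneg _) (N₂.dominated c a σ hσ h) 2))
  lower a b hab := by
    change √_ ^ 2 + √_ ^ 2 ≤ √_ ^ 2
    rw [Real.sq_sqrt (by positivity), Real.sq_sqrt (by positivity), Real.sq_sqrt (by positivity)]
    linarith [N₁.lower a b hab, N₂.lower a b hab]
  tensor c a b σ τ hστ h := by
    change √_ ≤ √_ * √_
    rw [← Real.sqrt_mul (by positivity)]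
    refine Real.sqrt_le_sqrt ?_
    have h1 := pow_le_pow_left₀ (N₁.nonneg _) (N₁.tensor c a b σ τ hστ h) 2
    have h2 := pow_le_pow_left₀ (N₂.nonneg _) (N₂.tensor c a b σ τ hστ h) 2
    rw [mul_pow] at h1 h2
    nlinarith [mul_nonneg (sq_nonneg (N₁ a)) (sq_nonneg (N₂ b)),
      mul_nonneg (sq_nonneg (N₂ a)) (sq_nonneg (N₁ b))]
  one_le := by
    change 1 ≤ √_
    rw [Real.one_le_sqrt]
    nlinarith [N₁.one_le, N₂.one_le]
  average := by
    have h := (N₁.average.pow 2).add (N₂.average.pow 2)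
    have h' := (Real.continuous_sqrt.tendsto _).comp h
    simp only [ne_eq, OfNat.ofNat_ne_zero, not_false_eq_true, zero_pow, add_zero,
      Real.sqrt_zero] at h'
    refine h'.congr fun n => ?_
    change √(_ ^ 2 + _ ^ 2) = √_ / _
    rw [div_pow, div_pow, ← add_div, Real.sqrt_div (by positivity), Real.sqrt_sq (by positivity)]

theorem hilbertSum_sq (N₁ N₂ : TensorNorm) (c : ℕ →₀ ℝ) :
    hilbertSum N₁ N₂ c ^ 2 = N₁ c ^ 2 + N₂ c ^ 2 := by
  change √_ ^ 2 = _
  rw [Real.sq_sqrt (by positivity)]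

end TensorNorm

theorem sum_indicator_fiber_le {ι : Type*} [DecidableEq ι] (s : Finset ℕ) (σ : ℕ → ι)
    (f : ℕ → ℝ) (F : Finset ι) :
    ∑ i ∈ F, ∑ p ∈ s with σ p = i, f p = ∑ p ∈ s with σ p ∈ F, f p := by
  rw [← Finset.sum_fiberwise_of_maps_to (s := s.filter (fun p => σ p ∈ F)) (t := F) (g := σ)
    (fun p hp => (Finset.mem_filter.mp hp).2)]
  refine Finset.sum_congr rfl fun i hi => Finset.sum_congr ?_ fun _ _ => rfl
  ext p
  simp only [Finset.mem_filter]
  constructor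
  · rintro ⟨h1, rfl⟩
    exact ⟨⟨h1, hi⟩, rfl⟩
  · rintro ⟨⟨h1, -⟩, h2⟩
    exact ⟨h1, h2⟩

/-- Sums over a finite set, grouped along a map into the support of `a`. -/
theorem sum_abs_mul_fiber (s : Finset ℕ) (σ : ℕ → ℕ) (a : ℕ →₀ ℝ) (f : ℕ → ℝ) :
    ∑ p ∈ s, |a (σ p)| * f p = ∑ i ∈ a.support, |a i| * ∑ p ∈ s with σ p = i, f p := by
  have h := sum_indicator_fiber_le s σ (fun p => |a (σ p)| * f p) a.support
  rw [Finset.sum_filter_of_ne] at h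
  · rw [← h]
    refine Finset.sum_congr rfl fun i _ => ?_
    rw [Finset.mul_sum]
    refine Finset.sum_congr rfl fun p hp => ?_
    rw [(Finset.mem_filter.mp hp).2]
  · intro p _ hp
    rw [Finsupp.mem_support_iff]
    rintro h0
    simp [h0] at hp

/-- Weights that define a Lorentz-type norm. -/
structure LorentzWeight where
  /-- the norm of a characteristic function of `n` points -/
  toFun : ℕ → ℝ
  nonneg : ∀ n, 0 ≤ toFun n
  mul_le : ∀ m n, toFun (m * n) ≤ toFun m * toFun n
  sq_add_le : ∀ m n, toFun m ^ 2 + toFun n ^ 2 ≤ toFun (m + n) ^ 2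
  quasiconcave : ∀ m n, m ≤ n → m * toFun n ≤ n * toFun m
  one : toFun 1 = 1
  average : Tendsto (fun n : ℕ => toFun n / n) atTop (𝓝 0)

namespace LorentzWeight

instance : CoeFun LorentzWeight fun _ => ℕ → ℝ := ⟨LorentzWeight.toFun⟩

variable (W : LorentzWeight)

theorem mono {m n : ℕ} (h : m ≤ n) : W m ≤ W n := by
  obtain ⟨k, rfl⟩ := Nat.exists_eq_add_of_le h
  refine abs_le_of_sq_le_sq' ?_ (W.nonneg _) |>.2
  nlinarith [W.sq_add_le m k, sq_nonneg (W k)]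

/-- The nonnegative functionals that are dominated by the weight on characteristic functions. -/
def Feasible (W : LorentzWeight) (R : ℝ) (g : ℕ → ℝ) : Prop :=
  (∀ p, 0 ≤ g p) ∧ ∀ F : Finset ℕ, ∑ p ∈ F, g p ≤ R * W F.card

theorem feasible_zero : W.Feasible 1 0 :=
  ⟨fun _ => le_rfl, fun F => by simpa using W.nonneg _⟩

/-- The Lorentz norm of a finitely supported sequence. -/
noncomputable def norm (c : ℕ →₀ ℝ) : ℝ :=
  ⨆ g : {g : ℕ → ℝ // W.Feasible 1 g}, ∑ p ∈ c.support, |c p| * g.1 p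

instance : Nonempty {g : ℕ → ℝ // W.Feasible 1 g} := ⟨⟨0, W.feasible_zero⟩⟩

theorem Feasible.le_one {g : ℕ → ℝ} (hg : W.Feasible 1 g) (p : ℕ) : g p ≤ 1 := by
  simpa [W.one] using hg.2 {p}

theorem bddAbove_norm (c : ℕ →₀ ℝ) : BddAbove (Set.range
    fun g : {g : ℕ → ℝ // W.Feasible 1 g} => ∑ p ∈ c.support, |c p| * g.1 p) := by
  refine ⟨∑ p ∈ c.support, |c p|, ?_⟩
  rintro _ ⟨g, rfl⟩
  exact Finset.sum_le_sum fun p _ =>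
    mul_le_of_le_one_right (abs_nonneg _) (Feasible.le_one W g.2 p)

theorem norm_nonneg (c : ℕ →₀ ℝ) : 0 ≤ W.norm c :=
  Real.iSup_nonneg fun g => Finset.sum_nonneg fun p _ => mul_nonneg (abs_nonneg _) (g.2.1 p)

theorem sum_le_norm_of_feasible_one {g : ℕ → ℝ} (hg : W.Feasible 1 g) (c : ℕ →₀ ℝ)
    (s : Finset ℕ) : ∑ p ∈ s, |c p| * g p ≤ W.norm c := by
  classical
  refine le_trans ?_ (le_ciSup (W.bddAbove_norm c) ⟨g, hg⟩)
  calc ∑ p ∈ s, |c p| * g p = ∑ p ∈ s with p ∈ c.support, |c p| * g p := by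
        rw [Finset.sum_filter_of_ne]
        intro p _ hp
        rw [Finsupp.mem_support_iff]
        rintro h0
        simp [h0] at hp
    _ ≤ _ := Finset.sum_le_sum_of_subset_of_nonneg
        (fun p hp => (Finset.mem_filter.mp hp).2)
        fun p _ _ => mul_nonneg (abs_nonneg _) (hg.1 p)

theorem sum_le_norm {R : ℝ} (hR : 0 ≤ R) {g : ℕ → ℝ} (hg : W.Feasible R g) (c : ℕ →₀ ℝ)
    (s : Finset ℕ) : ∑ p ∈ s, |c p| * g p ≤ R * W.norm c := by
  rcases hR.eq_or_lt with rfl | hR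
  · have h0 : ∀ p, g p = 0 := fun p => le_antisymm (by simpa using hg.2 {p}) (hg.1 p)
    simp [h0]
  · have h := W.sum_le_norm_of_feasible_one (g := fun p => R⁻¹ * g p)
      ⟨fun p => mul_nonneg (by positivity) (hg.1 p), fun F => by
        rw [← Finset.mul_sum, one_mul, inv_mul_le_iff₀ hR]
        exact hg.2 F⟩ c s
    rw [← inv_mul_le_iff₀ hR, Finset.mul_sum]
    refine le_of_eq_of_le (Finset.sum_congr rfl fun p _ => ?_) h
    ring

theorem norm_le {c : ℕ →₀ ℝ} {B : ℝ}
    (h : ∀ g, W.Feasible 1 g → ∑ p ∈ c.support, |c p| * g p ≤ B) : W.norm c ≤ B :=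
  ciSup_le fun g => h g.1 g.2

theorem norm_add_le (a b : ℕ →₀ ℝ) : W.norm (a + b) ≤ W.norm a + W.norm b := by
  refine W.norm_le fun g hg => ?_
  refine le_trans ?_ (add_le_add (W.sum_le_norm_of_feasible_one hg a (a + b).support)
    (W.sum_le_norm_of_feasible_one hg b (a + b).support))
  rw [← Finset.sum_add_distrib]
  refine Finset.sum_le_sum fun p _ => ?_
  rw [← add_mul]
  exact mul_le_mul_of_nonneg_right (abs_add_le _ _) (hg.1 p)

theorem norm_smul_le (t : ℝ) (a : ℕ →₀ ℝ) : W.norm (t • a) ≤ |t| * W.norm a := by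
  refine W.norm_le fun g hg => ?_
  refine le_trans (le_of_eq ?_) (mul_le_mul_of_nonneg_left
    (W.sum_le_norm_of_feasible_one hg a (t • a).support) (abs_nonneg t))
  rw [Finset.mul_sum]
  refine Finset.sum_congr rfl fun p _ => ?_
  rw [Finsupp.smul_apply, smul_eq_mul, abs_mul, mul_assoc]

theorem norm_smul (t : ℝ) (a : ℕ →₀ ℝ) : W.norm (t • a) = |t| * W.norm a := by
  refine le_antisymm (W.norm_smul_le t a) ?_
  rcases eq_or_ne t 0 with rfl | ht
  · simpa using W.norm_nonneg _
  · have h := W.norm_smul_le t⁻¹ (t • a)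
    rw [smul_smul, inv_mul_cancel₀ ht, one_smul, abs_inv] at h
    rwa [← le_inv_mul_iff₀ (abs_pos.mpr ht)]

theorem norm_tensor (c a b : ℕ →₀ ℝ) (σ τ : ℕ → ℕ)
    (hστ : Set.InjOn (fun p => (σ p, τ p)) c.support)
    (h : ∀ p, |c p| ≤ |a (σ p)| * |b (τ p)|) : W.norm c ≤ W.norm a * W.norm b := by
  refine W.norm_le fun g hg => ?_
  set s := c.support
  let u : ℕ → ℝ := fun i => ∑ p ∈ s with σ p = i, |b (τ p)| * g p
  have hu : W.Feasible (W.norm b) u := by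
    refine ⟨fun i => Finset.sum_nonneg fun p _ => mul_nonneg (abs_nonneg _) (hg.1 p),
      fun F => ?_⟩
    rw [sum_indicator_fiber_le s σ (fun p => |b (τ p)| * g p) F, sum_abs_mul_fiber, mul_comm]
    refine W.sum_le_norm (W.nonneg _) ⟨fun j => Finset.sum_nonneg fun p _ => hg.1 p,
      fun G => ?_⟩ b _
    rw [sum_indicator_fiber_le _ τ g G]
    refine (hg.2 _).trans ?_
    rw [one_mul]
    refine le_trans (W.mono ?_) (W.mul_le F.card G.card)
    rw [← Finset.card_product]
    refine Finset.card_le_card_of_injOn (fun p => (σ p, τ p)) (fun p hp => ?_) (hστ.mono ?_)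
    · simp only [Finset.coe_filter, Finset.mem_filter, Set.mem_ofPred_eq] at hp
      simp [hp.1.2, hp.2]
    · intro p hp
      simp only [Finset.coe_filter, Finset.mem_filter, Set.mem_ofPred_eq] at hp
      exact hp.1.1
  calc ∑ p ∈ s, |c p| * g p ≤ ∑ p ∈ s, |a (σ p)| * (|b (τ p)| * g p) := by
        refine Finset.sum_le_sum fun p _ => ?_
        rw [← mul_assoc]
        exact mul_le_mul_of_nonneg_right (h p) (hg.1 p)
    _ = ∑ i ∈ a.support, |a i| * u i := sum_abs_mul_fiber s σ a _
    _ ≤ W.norm b * W.norm a := W.sum_le_norm (W.norm_nonneg b) hu a _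
    _ = _ := mul_comm _ _

theorem norm_restr_one (F : Finset ℕ) : W.norm (restr 1 F) = W F.card := by
  refine le_antisymm (W.norm_le fun g hg => ?_) ?_
  · refine le_trans ?_ ((hg.2 F).trans_eq (one_mul _))
    refine (Finset.sum_le_sum fun p hp => le_of_eq ?_).trans
      (Finset.sum_le_sum_of_subset_of_nonneg (support_restr_subset 1 F) fun p _ _ => hg.1 p)
    rw [restr_apply_mem (support_restr_subset 1 F hp)]
    simp
  · rcases F.eq_empty_or_nonempty with rfl | hF
    · have h0 : W 0 = 0 := by
        have := W.quasiconcave 0 1 (by norm_num)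
        simp only [CharP.cast_eq_zero, zero_mul, Nat.cast_one, one_mul] at this
        have h2 := W.sq_add_le 0 1
        rw [zero_add] at h2
        nlinarith
      simpa [h0] using W.norm_nonneg _
    have hpos : (0 : ℝ) < F.card := by exact_mod_cast hF.card_pos
    have h := W.sum_le_norm_of_feasible_one
      (g := fun p => if p ∈ F then W F.card / F.card else 0) ⟨fun p => ?_, fun G => ?_⟩
      (restr 1 F) F
    · refine le_trans (le_of_eq ?_) h
      rw [Finset.sum_congr rfl (g := fun _ => W F.card / F.card) fun p hp => ?_]
      · rw [Finset.sum_const, nsmul_eq_mul]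
        field_simp
      · rw [restr_apply_mem hp, if_pos hp]
        simp
    · dsimp only
      split_ifs
      exacts [div_nonneg (W.nonneg _) hpos.le, le_rfl]
    · rw [Finset.sum_ite_mem, Finset.sum_const, nsmul_eq_mul, one_mul, mul_div_assoc',
        div_le_iff₀ hpos]
      refine (W.quasiconcave _ _ (Finset.card_le_card Finset.inter_subset_right)).trans ?_
      rw [mul_comm]
      exact mul_le_mul_of_nonneg_right
        (W.mono (Finset.card_le_card Finset.inter_subset_left)) hpos.le

theorem norm_single_zero : W.norm (Finsupp.single 0 1) = 1 := by
  have h := W.norm_restr_one {0}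
  rw [restr_eq_sum] at h
  simpa [W.one] using h

theorem norm_lower (a b : ℕ →₀ ℝ) (hab : Disjoint a.support b.support) :
    W.norm a ^ 2 + W.norm b ^ 2 ≤ W.norm (a + b) ^ 2 := by
  classical
  set u := W.norm a
  set v := W.norm b
  have hu : 0 ≤ u := W.norm_nonneg a
  have hv : 0 ≤ v := W.norm_nonneg b
  set r := √(u ^ 2 + v ^ 2)
  have hr : 0 ≤ r := Real.sqrt_nonneg _
  have hr2 : r ^ 2 = u ^ 2 + v ^ 2 := Real.sq_sqrt (by positivity)
  have key : ∀ g h : ℕ → ℝ, W.Feasible 1 g → W.Feasible 1 h →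
      u * (∑ p ∈ a.support, |a p| * g p) + v * (∑ p ∈ b.support, |b p| * h p) ≤
        r * W.norm (a + b) := by
    intro g h hg hh
    have hf : W.Feasible r
        (fun p => if p ∈ a.support then u * g p else if p ∈ b.support then v * h p else 0) := by
      refine ⟨fun p => ?_, fun F => ?_⟩
      · have := mul_nonneg hu (hg.1 p)
        have := mul_nonneg hv (hh.1 p)
        dsimp only
        split_ifs <;> simp_all
      · have hs : ∀ p, (if p ∈ a.support then u * g p else if p ∈ b.support then v * h p else 0) =
            (if p ∈ a.support then u * g p else 0) + (if p ∈ b.support then v * h p else 0) := by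
          intro p
          by_cases hp : p ∈ a.support
          · rw [if_pos hp, if_pos hp, if_neg (Finset.disjoint_left.mp hab hp), add_zero]
          · rw [if_neg hp, if_neg hp, zero_add]
        simp only [hs]
        rw [Finset.sum_add_distrib, Finset.sum_ite_mem, Finset.sum_ite_mem, ← Finset.mul_sum,
          ← Finset.mul_sum]
        have h1 := hg.2 (F ∩ a.support)
        have h2 := hh.2 (F ∩ b.support)
        rw [one_mul] at h1 h2
        set m := (F ∩ a.support).card
        set n := (F ∩ b.support).card
        have hmn : m + n ≤ F.card := by
          rw [← Finset.card_union_of_disjoint]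
          · exact Finset.card_le_card
              (Finset.union_subset Finset.inter_subset_left Finset.inter_subset_left)
          · exact hab.mono Finset.inter_subset_right Finset.inter_subset_right
        have h3 : u * W m + v * W n ≤ r * W (m + n) := by
          refine abs_le_of_sq_le_sq' ?_ (mul_nonneg hr (W.nonneg _)) |>.2
          rw [mul_pow, hr2]
          have h4 := mul_le_mul_of_nonneg_left (W.sq_add_le m n)
            (by positivity : 0 ≤ u ^ 2 + v ^ 2)
          nlinarith [sq_nonneg (u * W n - v * W m)]
        calc u * _ + v * _ ≤ u * W m + v * W n := by gcongr
          _ ≤ _ := h3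
          _ ≤ _ := mul_le_mul_of_nonneg_left (W.mono hmn) hr
    refine le_trans (le_of_eq ?_) (W.sum_le_norm hr hf (a + b) (a.support ∪ b.support))
    rw [Finset.sum_union hab, Finset.mul_sum, Finset.mul_sum]
    congr 1
    · refine Finset.sum_congr rfl fun p hp => ?_
      have hb : b p = 0 := by simpa using Finset.disjoint_left.mp hab hp
      rw [if_pos hp, Finsupp.add_apply, hb, add_zero]
      ring
    · refine Finset.sum_congr rfl fun p hp => ?_
      have ha' := Finset.disjoint_right.mp hab hp
      have ha : a p = 0 := by simpa using ha'
      rw [if_neg ha', if_pos hp, Finsupp.add_apply, ha, zero_add]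
      ring
  have k2 : ∀ g, W.Feasible 1 g →
      u * (∑ p ∈ a.support, |a p| * g p) + v * v ≤ r * W.norm (a + b) := by
    intro g hg
    rcases hv.eq_or_lt with h0 | hpos
    · have := key g 0 hg W.feasible_zero
      simpa [← h0] using this
    · suffices v ≤ (r * W.norm (a + b) - u * ∑ p ∈ a.support, |a p| * g p) / v by
        rw [le_div_iff₀ hpos] at this
        linarith
      refine W.norm_le fun h hh => ?_
      rw [le_div_iff₀ hpos]
      linarith [key g h hg hh]
  have k3 : u * u + v * v ≤ r * W.norm (a + b) := by
    rcases hu.eq_or_lt with h0 | hpos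
    · have := k2 0 W.feasible_zero
      simpa [← h0] using this
    · suffices u ≤ (r * W.norm (a + b) - v * v) / u by
        rw [le_div_iff₀ hpos] at this
        linarith
      refine W.norm_le fun h hh => ?_
      rw [le_div_iff₀ hpos]
      linarith [k2 h hh]
  have k4 : r * r ≤ r * W.norm (a + b) := by nlinarith
  rw [← hr2]
  rcases hr.eq_or_lt with h0 | hpos
  · rw [← h0, zero_pow two_ne_zero]
    positivity
  · exact pow_le_pow_left₀ hr (le_of_mul_le_mul_left k4 hpos) 2

/-- The Lorentz norm of a weight as a `TensorNorm`. -/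
noncomputable def toTensorNorm : TensorNorm where
  toSeminorm := Seminorm.of W.norm W.norm_add_le W.norm_smul
  dominated c a σ hσ h := by
    have := W.norm_tensor c a (Finsupp.single 0 1) σ 0
      (fun p hp q hq hpq => hσ hp hq (congrArg Prod.fst hpq)) (by simpa using h)
    rw [W.norm_single_zero, mul_one] at this
    exact this
  lower := W.norm_lower
  tensor := W.norm_tensor
  one_le := W.norm_single_zero.ge
  average := by
    refine W.average.congr fun n => ?_
    change _ = W.norm _ / _
    rw [W.norm_restr_one, Finset.card_range]

theorem toTensorNorm_restr_one (F : Finset ℕ) : W.toTensorNorm (restr 1 F) = W F.card :=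
  W.norm_restr_one F

end LorentzWeight

namespace TensorNorm

theorem sum_support_eq (f : ℝ → ℝ) (hf : f 0 = 0) (c : ℕ →₀ ℝ) {s : Finset ℕ}
    (h : c.support ⊆ s) : ∑ p ∈ c.support, f (c p) = ∑ p ∈ s, f (c p) :=
  Finset.sum_subset h fun p _ hp => by rw [Finsupp.notMem_support_iff.mp hp, hf]

/-- The norm of `ℓ₂`. -/
noncomputable def l2 : TensorNorm where
  toSeminorm := Seminorm.of (fun c => √(∑ p ∈ c.support, c p ^ 2))
    (fun a b => by
      classical
      rw [sum_support_eq (· ^ 2) (by simp) (a + b) Finsupp.support_add,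
        sum_support_eq (· ^ 2) (by simp) a (Finset.subset_union_left (s₂ := b.support)),
        sum_support_eq (· ^ 2) (by simp) b (Finset.subset_union_right (s₁ := a.support))]
      have h := sqrt_sum_sq_le_add (a.support ∪ b.support)
        (f := fun i => |(a + b) i|) (g := fun i => |a i|) (h := fun i => |b i|)
        (by simp) (by simp) (by simp) (fun i _ => abs_add_le _ _)
      simpa [sq_abs] using h)
    (fun t a => by
      rw [sum_support_eq (· ^ 2) (by simp) (t • a) Finsupp.support_smul]
      simp only [Finsupp.smul_apply, smul_eq_mul, mul_pow, ← Finset.mul_sum]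
      rw [Real.sqrt_mul (by positivity), Real.sqrt_sq_eq_abs, Real.norm_eq_abs])
  dominated c a σ hσ h := by
    classical
    refine Real.sqrt_le_sqrt ?_
    calc ∑ p ∈ c.support, c p ^ 2 ≤ ∑ p ∈ c.support, a (σ p) ^ 2 :=
          Finset.sum_le_sum fun p _ => sq_le_sq.mpr (h p)
      _ = ∑ q ∈ c.support.image σ, a q ^ 2 :=
          (Finset.sum_image (f := fun q => a q ^ 2) hσ).symm
      _ ≤ ∑ q ∈ a.support, a q ^ 2 := by
          refine Finset.sum_le_sum_of_subset_of_nonneg (fun q hq => ?_) fun _ _ _ => sq_nonneg _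
          obtain ⟨p, hp, rfl⟩ := Finset.mem_image.mp hq
          rw [Finsupp.mem_support_iff] at hp ⊢
          exact fun h0 => hp (by simpa [h0] using h p)
  lower a b hab := by
    classical
    change √_ ^ 2 + √_ ^ 2 ≤ √_ ^ 2
    rw [Real.sq_sqrt (by positivity), Real.sq_sqrt (by positivity), Real.sq_sqrt (by positivity),
      sum_support_eq (· ^ 2) (by simp) (a + b) Finsupp.support_add, Finset.sum_union hab]
    refine le_of_eq (congrArg₂ _ (Finset.sum_congr rfl fun p hp => ?_)
      (Finset.sum_congr rfl fun p hp => ?_))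
    · have hb : b p = 0 := by simpa using Finset.disjoint_left.mp hab hp
      rw [Finsupp.add_apply, hb, add_zero]
    · have ha : a p = 0 := by simpa using Finset.disjoint_right.mp hab hp
      rw [Finsupp.add_apply, ha, zero_add]
  tensor c a b σ τ hστ h := by
    classical
    change √_ ≤ √_ * √_
    rw [← Real.sqrt_mul (by positivity)]
    refine Real.sqrt_le_sqrt ?_
    rw [Finset.sum_mul_sum, ← Finset.sum_product']
    calc ∑ p ∈ c.support, c p ^ 2 ≤ ∑ p ∈ c.support, a (σ p) ^ 2 * b (τ p) ^ 2 :=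
          Finset.sum_le_sum fun p _ => by
            rw [← mul_pow]
            exact sq_le_sq.mpr ((h p).trans_eq (abs_mul _ _).symm)
      _ = ∑ q ∈ c.support.image fun p => (σ p, τ p), a q.1 ^ 2 * b q.2 ^ 2 :=
          (Finset.sum_image (f := fun q : ℕ × ℕ => a q.1 ^ 2 * b q.2 ^ 2) hστ).symm
      _ ≤ _ := by
          refine Finset.sum_le_sum_of_subset_of_nonneg (fun q hq => ?_)
            fun _ _ _ => by positivity
          obtain ⟨p, hp, rfl⟩ := Finset.mem_image.mp hq
          rw [Finsupp.mem_support_iff] at hp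
          rw [Finset.mem_product, Finsupp.mem_support_iff, Finsupp.mem_support_iff]
          exact ⟨fun h0 => hp (by simpa [h0] using h p), fun h0 => hp (by simpa [h0] using h p)⟩
  one_le := by
    change 1 ≤ √_
    rw [sum_support_eq (· ^ 2) (by simp) _ Finsupp.support_single_subset]
    simp
  average := by
    have h : Tendsto (fun n : ℕ => (√(n : ℝ))⁻¹) atTop (𝓝 0) :=
      (Real.tendsto_sqrt_atTop.comp tendsto_natCast_atTop_atTop).inv_tendsto_atTop
    refine h.congr fun n => ?_
    change _ = √_ / _
    rw [sum_support_eq (· ^ 2) (by simp) _ (support_restr_subset _ _),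
      Finset.sum_congr rfl (g := fun _ => (1 : ℝ)) fun p hp => by simp [restr_apply_mem hp]]
    simp [Real.sqrt_div_self]

theorem l2_sq (c : ℕ →₀ ℝ) : l2 c ^ 2 = ∑ p ∈ c.support, c p ^ 2 :=
  Real.sq_sqrt (by positivity)

theorem l2_restr_sq (x : ℕ → ℝ) (E : Finset ℕ) : l2 (restr x E) ^ 2 = ∑ p ∈ E, x p ^ 2 := by
  rw [l2_sq, sum_support_eq (· ^ 2) (by simp) _ (support_restr_subset _ _)]
  exact Finset.sum_congr rfl fun p hp => by rw [restr_apply_mem hp]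

theorem l2_le (N : TensorNorm) (c : ℕ →₀ ℝ) : l2 c ≤ N c := by
  refine abs_le_of_sq_le_sq' ?_ (N.nonneg c) |>.2
  have h := N.sum_sq_le c c.support
  rwa [restr_of_support_subset (Finset.Subset.refl _), ← l2_sq] at h

/-- The `ℓ₂`-sum of `ℓ₂` and a finite family of norms. -/
theorem exists_hilbertSum {ι : Type*} (s : Finset ι) (N : ι → TensorNorm) :
    ∃ M : TensorNorm, ∀ c, M c ^ 2 = l2 c ^ 2 + ∑ i ∈ s, N i c ^ 2 := by
  classical
  induction s using Finset.induction_on with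
  | empty => exact ⟨l2, fun c => by simp⟩
  | insert i s hi ih =>
    obtain ⟨M, hM⟩ := ih
    refine ⟨hilbertSum M (N i), fun c => ?_⟩
    rw [hilbertSum_sq, hM, Finset.sum_insert hi]
    ring

end TensorNorm

namespace LorentzWeight

/-- The infimum of the powers `B j * n ^ θ j`. -/
noncomputable def powerInf (B θ : ℕ → ℝ) (n : ℕ) : ℝ := ⨅ j, B j * (n : ℝ) ^ θ j

section

variable {B θ : ℕ → ℝ} (hB : ∀ j, 1 ≤ B j)
include hB

theorem term_nonneg (n j : ℕ) : 0 ≤ B j * (n : ℝ) ^ θ j :=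
  mul_nonneg (zero_le_one.trans (hB j)) (by positivity)

theorem powerInf_nonneg (n : ℕ) : 0 ≤ powerInf B θ n := Real.iInf_nonneg (term_nonneg hB n)

theorem powerInf_le (n j : ℕ) : powerInf B θ n ≤ B j * (n : ℝ) ^ θ j :=
  ciInf_le ⟨0, by rintro _ ⟨i, rfl⟩; exact term_nonneg hB n i⟩ j

end

end LorentzWeight

open LorentzWeight in
/-- The weight given by an infimum of power functions with exponents in `[1/2, 1]`. -/
noncomputable def LorentzWeight.ofPowers (B θ : ℕ → ℝ) (hB : ∀ j, 1 ≤ B j)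
    (hB1 : ∃ j, B j = 1) (hθ : ∀ j, 1 / 2 ≤ θ j) (hθ1 : ∀ j, θ j ≤ 1) (hθ2 : ∃ j, θ j < 1) :
    LorentzWeight where
  toFun := powerInf B θ
  nonneg := powerInf_nonneg hB
  mul_le m n := by
    have hpos : ∀ j, θ j ≠ 0 := fun j => by linarith [hθ j]
    have mono : ∀ (k : ℕ) (i j : ℕ), θ i ≤ θ j → (k : ℝ) ^ θ i ≤ B j * (k : ℝ) ^ θ j := by
      intro k i j hij
      rcases Nat.eq_zero_or_pos k with rfl | hk
      · simp [Real.zero_rpow (hpos i), Real.zero_rpow (hpos j)]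
      · have hk1 : (1 : ℝ) ≤ k := by exact_mod_cast hk
        exact (Real.rpow_le_rpow_of_exponent_le hk1 hij).trans
          (le_mul_of_one_le_left (by positivity) (hB j))
    have key : ∀ i j, powerInf B θ (m * n) ≤ B i * (m : ℝ) ^ θ i * (B j * (n : ℝ) ^ θ j) := by
      intro i j
      rcases le_total (θ i) (θ j) with h | h
      · refine (powerInf_le hB _ i).trans ?_
        rw [Nat.cast_mul, Real.mul_rpow (by positivity) (by positivity), ← mul_assoc]
        exact mul_le_mul_of_nonneg_left (mono n i j h) (term_nonneg hB m i)
      · refine (powerInf_le hB _ j).trans ?_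
        rw [Nat.cast_mul, Real.mul_rpow (by positivity) (by positivity), mul_left_comm]
        exact mul_le_mul_of_nonneg_right (mono m j i h) (term_nonneg hB n j)
    have k2 : ∀ i, powerInf B θ (m * n) ≤ B i * (m : ℝ) ^ θ i * powerInf B θ n := by
      intro i
      conv_rhs => rw [powerInf, Real.mul_iInf_of_nonneg (term_nonneg hB m i)]
      exact le_ciInf (key i)
    conv_rhs => rw [powerInf, Real.iInf_mul_of_nonneg (powerInf_nonneg hB n)]
    exact le_ciInf k2
  sq_add_le m n := by
    have h : √(powerInf B θ m ^ 2 + powerInf B θ n ^ 2) ≤ powerInf B θ (m + n) := by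
      refine le_ciInf fun j => Real.sqrt_le_iff.mpr ⟨term_nonneg hB _ j, ?_⟩
      have h1 := pow_le_pow_left₀ (powerInf_nonneg hB m) (powerInf_le (θ := θ) hB m j) 2
      have h2 := pow_le_pow_left₀ (powerInf_nonneg hB n) (powerInf_le (θ := θ) hB n j) 2
      have e : ∀ k : ℕ, (B j * (k : ℝ) ^ θ j) ^ 2 = B j ^ 2 * (k : ℝ) ^ (θ j * 2) := fun k => by
        rw [mul_pow, ← Real.rpow_natCast, ← Real.rpow_natCast, ← Real.rpow_mul (by positivity)]
        norm_num
      rw [e] at h1 h2 ⊢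
      have h3 := Real.add_rpow_le_rpow_add (a := (m : ℝ)) (b := n) (p := θ j * 2)
        (by positivity) (by positivity) (by linarith [hθ j])
      push_cast
      have h4 := mul_le_mul_of_nonneg_left h3 (sq_nonneg (B j))
      linarith
    calc _ = √(powerInf B θ m ^ 2 + powerInf B θ n ^ 2) ^ 2 := (Real.sq_sqrt (by positivity)).symm
      _ ≤ _ := pow_le_pow_left₀ (Real.sqrt_nonneg _) h 2
  quasiconcave m n hmn := by
    rcases Nat.eq_zero_or_pos m with rfl | hm
    · simpa using mul_nonneg (Nat.cast_nonneg n) (powerInf_nonneg hB 0)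
    have hm' : (0 : ℝ) < m := by exact_mod_cast hm
    have hn' : (0 : ℝ) < n := hm'.trans_le (by exact_mod_cast hmn)
    conv_rhs => rw [powerInf, Real.mul_iInf_of_nonneg hn'.le]
    refine le_ciInf fun j => (mul_le_mul_of_nonneg_left (powerInf_le hB n j) hm'.le).trans ?_
    have e : ∀ x : ℝ, 0 < x → x = x ^ (1 - θ j) * x ^ θ j := fun x hx => by
      rw [← Real.rpow_add hx]
      simp
    have h1 : (m : ℝ) ^ (1 - θ j) ≤ (n : ℝ) ^ (1 - θ j) :=
      Real.rpow_le_rpow hm'.le (by exact_mod_cast hmn) (by linarith [hθ1 j])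
    have h2 : 0 ≤ B j * (m : ℝ) ^ θ j * (n : ℝ) ^ θ j :=
      mul_nonneg (term_nonneg hB m j) (by positivity)
    calc (m : ℝ) * (B j * (n : ℝ) ^ θ j)
        = (m : ℝ) ^ (1 - θ j) * (B j * (m : ℝ) ^ θ j * (n : ℝ) ^ θ j) := by
          nth_rw 1 [e m hm']
          ring
      _ ≤ (n : ℝ) ^ (1 - θ j) * (B j * (m : ℝ) ^ θ j * (n : ℝ) ^ θ j) := by gcongr
      _ = n * (B j * (m : ℝ) ^ θ j) := by
          nth_rw 3 [e n hn']
          ring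
  one := by
    obtain ⟨j, hj⟩ := hB1
    refine le_antisymm ((powerInf_le hB 1 j).trans_eq (by simp [hj])) (le_ciInf fun j => ?_)
    simpa using hB j
  average := by
    obtain ⟨j, hj⟩ := hθ2
    have h := (((tendsto_rpow_neg_atTop (by linarith : 0 < 1 - θ j)).comp
      tendsto_natCast_atTop_atTop).const_mul (B j))
    rw [mul_zero] at h
    refine squeeze_zero' (Eventually.of_forall fun n =>
      div_nonneg (powerInf_nonneg hB n) (Nat.cast_nonneg n)) ?_ h
    filter_upwards [eventually_gt_atTop 0] with n hn
    have hn' : (0 : ℝ) < n := by exact_mod_cast hn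
    rw [div_le_iff₀ hn']
    refine (powerInf_le hB n j).trans_eq ?_
    change _ = B j * (n : ℝ) ^ (-(1 - θ j)) * n
    rw [mul_assoc, ← Real.rpow_add_one hn'.ne']
    ring_nf

namespace LorentzWeight

/-- The weight `n ↦ inf {2 ^ (t / 2) * n ^ (1 / 2 + 1 / (2 * t))}`, where `t` runs over the powers
`4 ^ (j + 1)` such that `j` does not have colour `s`. -/
noncomputable def lacunary (s : ℕ) : LorentzWeight :=
  ofPowers (fun j => if j.unpair.1 = s then 1 else (2 : ℝ) ^ ((4 : ℝ) ^ (j + 1) / 2))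
    (fun j => if j.unpair.1 = s then 1 else 1 / 2 + 1 / (2 * (4 : ℝ) ^ (j + 1)))
    (fun j => by
      split_ifs
      · rfl
      · exact Real.one_le_rpow (by norm_num) (by positivity))
    ⟨Nat.pair s 0, by simp⟩
    (fun j => by
      split_ifs
      · norm_num
      · linarith [show (0 : ℝ) ≤ 1 / (2 * (4 : ℝ) ^ (j + 1)) by positivity])
    (fun j => by
      split_ifs
      · rfl
      · have h : (1 : ℝ) ≤ 4 ^ (j + 1) := one_le_pow₀ (by norm_num)
        have : 1 / (2 * (4 : ℝ) ^ (j + 1)) ≤ 1 / (2 * 1) := by gcongr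
        linarith)
    ⟨Nat.pair (s + 1) 0, by
      have h : (1 : ℝ) < 4 ^ (Nat.pair (s + 1) 0 + 1) := one_lt_pow₀ (by norm_num) (by omega)
      have : 1 / (2 * (4 : ℝ) ^ (Nat.pair (s + 1) 0 + 1)) < 1 / (2 * 1) := by gcongr
      simp only [Nat.unpair_pair, Nat.succ_ne_self, if_false]
      linarith⟩

theorem lacunary_apply (s n : ℕ) : lacunary s n =
    ⨅ j : ℕ, (if j.unpair.1 = s then 1 else (2 : ℝ) ^ ((4 : ℝ) ^ (j + 1) / 2)) *
      (n : ℝ) ^ (if j.unpair.1 = s then (1 : ℝ) else 1 / 2 + 1 / (2 * (4 : ℝ) ^ (j + 1))) := rfl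

theorem cast_two_pow_rpow (j : ℕ) (x : ℝ) :
    ((2 ^ 16 ^ (j + 1) : ℕ) : ℝ) ^ x = (2 : ℝ) ^ (((4 : ℝ) ^ (j + 1)) ^ 2 * x) := by
  rw [Real.rpow_mul (by norm_num), ← pow_mul, mul_comm (j + 1) 2, pow_mul]
  norm_num
  norm_cast

theorem lacunary_le {s j : ℕ} (h : j.unpair.1 ≠ s) : lacunary s (2 ^ 16 ^ (j + 1)) ≤
    (2 : ℝ) ^ (((4 : ℝ) ^ (j + 1)) ^ 2 / 2 + 4 ^ (j + 1)) := by
  rw [lacunary_apply]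
  refine (ciInf_le ⟨0, ?_⟩ j).trans_eq ?_
  · rintro _ ⟨i, rfl⟩
    exact mul_nonneg (by split_ifs <;> positivity) (by positivity)
  · rw [if_neg h, if_neg h, cast_two_pow_rpow, ← Real.rpow_add (by norm_num)]
    congr 1
    field_simp
    ring

theorem le_lacunary {s j : ℕ} (h : j.unpair.1 = s) :
    (2 : ℝ) ^ (((4 : ℝ) ^ (j + 1)) ^ 2 / 2 + 2 * 4 ^ (j + 1)) ≤
      lacunary s (2 ^ 16 ^ (j + 1)) := by
  rw [lacunary_apply]
  refine le_ciInf fun i => ?_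
  rw [cast_two_pow_rpow]
  have ht : (4 : ℝ) ≤ 4 ^ (j + 1) := by
    simpa using pow_le_pow_right₀ (by norm_num : (1 : ℝ) ≤ 4) (Nat.succ_le_succ (Nat.zero_le j))
  set t : ℝ := 4 ^ (j + 1) with ht'
  split_ifs with hi
  · rw [one_mul, mul_one]
    exact Real.rpow_le_rpow_of_exponent_le (by norm_num) (by nlinarith)
  · rw [← Real.rpow_add (by norm_num)]
    refine Real.rpow_le_rpow_of_exponent_le (by norm_num) ?_
    have hu : (0 : ℝ) < 4 ^ (i + 1) := by positivity
    have hij : i ≠ j := fun e => hi (e ▸ h)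
    have hcase : 4 * t ≤ 4 ^ (i + 1) ∨ 4 * 4 ^ (i + 1) ≤ t := by
      rcases lt_or_gt_of_ne hij with h1 | h1
      · right
        rw [ht', ← pow_succ']
        exact pow_le_pow_right₀ (by norm_num) (by omega)
      · left
        rw [ht', ← pow_succ']
        exact pow_le_pow_right₀ (by norm_num) (by omega)
    set u : ℝ := 4 ^ (i + 1)
    have e : u / 2 + t ^ 2 * (1 / 2 + 1 / (2 * u)) = t ^ 2 / 2 + (u / 2 + t ^ 2 / (2 * u)) := by
      field_simp
      ring
    rw [e]
    refine add_le_add le_rfl ?_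
    rcases hcase with h1 | h1
    · have : 0 ≤ t ^ 2 / (2 * u) := by positivity
      linarith
    · have : 2 * t ≤ t ^ 2 / (2 * u) := by
        rw [le_div_iff₀ (by positivity)]
        nlinarith
      linarith

end LorentzWeight

/-- A finite family of disjoint finite sets of positions, each of which has at most as many
elements as its first position. -/
structure IsSchreierFamily (𝓔 : Finset (Finset ℕ)) : Prop where
  disjoint : (𝓔 : Set (Finset ℕ)).PairwiseDisjoint id
  card_le : ∀ E ∈ 𝓔, ∀ i ∈ E, E.card ≤ i + 1

theorem IsSchreierFamily.empty : IsSchreierFamily ∅ := ⟨by simp, by simp⟩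

theorem IsSchreierFamily.singleton {E : Finset ℕ} (h : ∀ i ∈ E, E.card ≤ i + 1) :
    IsSchreierFamily {E} := ⟨by simp, by simpa using h⟩

theorem IsSchreierFamily.mono {𝓔 𝓕 : Finset (Finset ℕ)} (h : IsSchreierFamily 𝓕) (hs : 𝓔 ⊆ 𝓕) :
    IsSchreierFamily 𝓔 :=
  ⟨h.disjoint.subset (by exact_mod_cast hs), fun E hE => h.card_le E (hs hE)⟩

/-- Among the sets of a disjoint family, at most `M` meet `{0, …, M - 1}`. -/
theorem IsSchreierFamily.card_filter_le {𝓔 : Finset (Finset ℕ)} (h : IsSchreierFamily 𝓔) (M : ℕ) :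
    (𝓔.filter fun E => ∃ i ∈ E, i < M).card ≤ M := by
  classical
  have hc : ∀ E ∈ 𝓔.filter (fun E => ∃ i ∈ E, i < M), ∃ i, i ∈ E ∧ i < M := fun E hE =>
    (Finset.mem_filter.mp hE).2
  choose! f hf using hc
  calc _ ≤ (Finset.range M).card := Finset.card_le_card_of_injOn f
        (fun E hE => by simpa using (hf E hE).2) fun E hE F hF hEF => by
          by_contra hne
          have hd := h.disjoint (Finset.mem_filter.mp hE).1 (Finset.mem_filter.mp hF).1 hne
          exact Finset.disjoint_left.mp hd (hf E hE).1 (by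
            rw [hEF]
            exact (hf F hF).1)
    _ = M := Finset.card_range M

namespace TensorNorm

variable (N : TensorNorm)

/-- The `ℓ₂`-sum of the norms of the restrictions to the sets of a family. -/
noncomputable def familyNorm (𝓔 : Finset (Finset ℕ)) (x : ℕ → ℝ) : ℝ :=
  √(∑ E ∈ 𝓔, N (restr x E) ^ 2)

theorem familyNorm_nonneg (𝓔 : Finset (Finset ℕ)) (x : ℕ → ℝ) : 0 ≤ N.familyNorm 𝓔 x :=
  Real.sqrt_nonneg _

theorem familyNorm_sq (𝓔 : Finset (Finset ℕ)) (x : ℕ → ℝ) :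
    N.familyNorm 𝓔 x ^ 2 = ∑ E ∈ 𝓔, N (restr x E) ^ 2 := Real.sq_sqrt (by positivity)

theorem familyNorm_zero (𝓔 : Finset (Finset ℕ)) : N.familyNorm 𝓔 0 = 0 := by
  simp [familyNorm, restr_zero]

theorem familyNorm_add_le (𝓔 : Finset (Finset ℕ)) (x y : ℕ → ℝ) :
    N.familyNorm 𝓔 (x + y) ≤ N.familyNorm 𝓔 x + N.familyNorm 𝓔 y :=
  sqrt_sum_sq_le_add 𝓔 (fun _ _ => N.nonneg _) (fun _ _ => N.nonneg _) (fun _ _ => N.nonneg _)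
    fun E _ => by
      rw [restr_add]
      exact N.add_le _ _

theorem familyNorm_smul (𝓔 : Finset (Finset ℕ)) (t : ℝ) (x : ℕ → ℝ) :
    N.familyNorm 𝓔 (t • x) = |t| * N.familyNorm 𝓔 x := by
  simp only [familyNorm, restr_smul, N.smul_eq, mul_pow, ← Finset.mul_sum]
  rw [Real.sqrt_mul (by positivity), Real.sqrt_sq (abs_nonneg t)]

theorem familyNorm_mono (𝓔 : Finset (Finset ℕ)) {x y : ℕ → ℝ} (h : ∀ p, |x p| ≤ |y p|) :
    N.familyNorm 𝓔 x ≤ N.familyNorm 𝓔 y :=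
  Real.sqrt_le_sqrt (Finset.sum_le_sum fun E _ => pow_le_pow_left₀ (N.nonneg _)
    (N.restr_mono (Finset.Subset.refl E) fun p _ => h p) 2)

theorem familyNorm_singleton (E : Finset ℕ) (x : ℕ → ℝ) : N.familyNorm {E} x = N (restr x E) := by
  rw [familyNorm, Finset.sum_singleton, Real.sqrt_sq (N.nonneg _)]

theorem familyNorm_finsupp_le {𝓔 : Finset (Finset ℕ)} (h : IsSchreierFamily 𝓔) (c : ℕ →₀ ℝ) :
    N.familyNorm 𝓔 c ≤ N c := by
  refine Real.sqrt_le_iff.mpr ⟨N.nonneg c, (N.sum_sq_restr_le c 𝓔 h.disjoint).trans ?_⟩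
  refine pow_le_pow_left₀ (N.nonneg _) (N.mono fun p => ?_) 2
  rw [restr_apply]
  split_ifs <;> simp

/-- The sequences whose norm in the Schreier space is finite. -/
noncomputable def schreierSubmodule : Submodule ℝ (ℕ → ℝ) where
  carrier := {x | ∃ C, ∀ 𝓔, IsSchreierFamily 𝓔 → N.familyNorm 𝓔 x ≤ C}
  zero_mem' := ⟨0, fun 𝓔 _ => (N.familyNorm_zero 𝓔).le⟩
  add_mem' := by
    rintro x y ⟨C, hC⟩ ⟨D, hD⟩
    exact ⟨C + D, fun 𝓔 h => (N.familyNorm_add_le 𝓔 x y).trans (add_le_add (hC 𝓔 h) (hD 𝓔 h))⟩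
  smul_mem' := by
    rintro t x ⟨C, hC⟩
    exact ⟨|t| * C, fun 𝓔 h => (N.familyNorm_smul 𝓔 t x).trans_le
      (mul_le_mul_of_nonneg_left (hC 𝓔 h) (abs_nonneg t))⟩

/-- The space of the sequences `x` for which the `ℓ₂`-sums of the `N`-norms of the restrictions of
`x` to disjoint Schreier sets are bounded. -/
def Space : Type := N.schreierSubmodule

namespace Space

variable {N}

noncomputable instance : AddCommGroup N.Space := inferInstanceAs (AddCommGroup N.schreierSubmodule)

noncomputable instance : Module ℝ N.Space := inferInstanceAs (Module ℝ N.schreierSubmodule)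

/-- The underlying sequence. -/
def toFun (x : N.Space) : ℕ → ℝ := Subtype.val x

instance : CoeFun N.Space fun _ => ℕ → ℝ := ⟨toFun⟩

@[ext] theorem ext {x y : N.Space} (h : ∀ p, x p = y p) : x = y := Subtype.ext (funext h)

theorem coe_add (x y : N.Space) : ((x + y : N.Space) : ℕ → ℝ) = x + y := rfl

theorem coe_smul (t : ℝ) (x : N.Space) : ((t • x : N.Space) : ℕ → ℝ) = t • x := rfl

@[simp] theorem add_apply (x y : N.Space) (p : ℕ) : (x + y) p = x p + y p := rfl

@[simp] theorem smul_apply (t : ℝ) (x : N.Space) (p : ℕ) : (t • x) p = t * x p := rfl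

@[simp] theorem zero_apply (p : ℕ) : (0 : N.Space) p = 0 := rfl

@[simp] theorem sub_apply (x y : N.Space) (p : ℕ) : (x - y) p = x p - y p := rfl

noncomputable instance : Norm N.Space :=
  ⟨fun x => ⨆ 𝓔 : {𝓔 // IsSchreierFamily 𝓔}, N.familyNorm 𝓔.1 x⟩

instance : Nonempty {𝓔 // IsSchreierFamily 𝓔} := ⟨⟨∅, IsSchreierFamily.empty⟩⟩

theorem familyNorm_le (x : N.Space) {𝓔 : Finset (Finset ℕ)} (h : IsSchreierFamily 𝓔) :
    N.familyNorm 𝓔 x ≤ ‖x‖ := by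
  obtain ⟨C, hC⟩ := x.2
  refine le_ciSup (f := fun 𝓔 : {𝓔 // IsSchreierFamily 𝓔} => N.familyNorm 𝓔.1 x) ⟨C, ?_⟩ ⟨𝓔, h⟩
  rintro _ ⟨𝓕, rfl⟩
  exact hC 𝓕.1 𝓕.2

theorem norm_le {x : N.Space} {C : ℝ} (h : ∀ 𝓔, IsSchreierFamily 𝓔 → N.familyNorm 𝓔 x ≤ C) :
    ‖x‖ ≤ C := ciSup_le fun 𝓔 => h 𝓔.1 𝓔.2

theorem restr_le (x : N.Space) {E : Finset ℕ} (h : ∀ i ∈ E, E.card ≤ i + 1) :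
    N (restr x E) ≤ ‖x‖ := by
  rw [← N.familyNorm_singleton]
  exact x.familyNorm_le (.singleton h)

theorem abs_apply_le (x : N.Space) (p : ℕ) : |x p| ≤ ‖x‖ :=
  (N.abs_le_restr x (Finset.mem_singleton_self p)).trans (x.restr_le (by simp))

theorem core : NormedSpace.Core ℝ N.Space where
  norm_nonneg x := Real.iSup_nonneg fun _ => N.familyNorm_nonneg _ _
  norm_smul t x := by
    refine le_antisymm (norm_le fun 𝓔 h => ?_) ?_
    · rw [coe_smul, N.familyNorm_smul]
      exact mul_le_mul_of_nonneg_left (x.familyNorm_le h) (abs_nonneg t)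
    · change _ * (⨆ _, _) ≤ _
      rw [Real.mul_iSup_of_nonneg (norm_nonneg t)]
      refine ciSup_le fun 𝓔 => ?_
      rw [Real.norm_eq_abs, ← N.familyNorm_smul]
      exact (t • x).familyNorm_le 𝓔.2
  norm_triangle x y := norm_le fun 𝓔 h => (N.familyNorm_add_le 𝓔 x y).trans
    (add_le_add (x.familyNorm_le h) (y.familyNorm_le h))
  norm_eq_zero_iff x := by
    constructor
    · intro h
      ext p
      simpa [h] using x.abs_apply_le p
    · rintro rfl
      refine le_antisymm (norm_le fun 𝓔 _ => (N.familyNorm_zero 𝓔).le) ?_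
      exact Real.iSup_nonneg fun _ => N.familyNorm_nonneg _ _

noncomputable instance : NormedAddCommGroup N.Space := NormedAddCommGroup.ofCore core

noncomputable instance : NormedSpace ℝ N.Space := NormedSpace.ofCore core

/-- The coordinate functionals. -/
noncomputable def coord (N : TensorNorm) (p : ℕ) : N.Space →L[ℝ] ℝ :=
  LinearMap.mkContinuous ⟨⟨fun x => x p, fun _ _ => rfl⟩, fun _ _ => rfl⟩ 1
    fun x => (x.abs_apply_le p).trans_eq (one_mul _).symm

@[simp] theorem coord_apply (p : ℕ) (x : N.Space) : coord N p x = x p := rfl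

theorem sum_apply {ι : Type*} (s : Finset ι) (f : ι → N.Space) (p : ℕ) :
    (∑ i ∈ s, f i) p = ∑ i ∈ s, f i p := by
  exact map_sum (coord N p) f s

theorem norm_mono {x y : N.Space} (h : ∀ p, |y p| ≤ |x p|) : ‖y‖ ≤ ‖x‖ :=
  norm_le fun 𝓔 h𝓔 => (N.familyNorm_mono 𝓔 h).trans (x.familyNorm_le h𝓔)

/-- The lower `2`-estimate for disjointly supported sequences. -/
theorem norm_sq_add_le {x y : N.Space} (h : ∀ p, x p = 0 ∨ y p = 0) :
    ‖x‖ ^ 2 + ‖y‖ ^ 2 ≤ ‖x + y‖ ^ 2 := by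
  classical
  have key : ∀ 𝓔 𝓕, IsSchreierFamily 𝓔 → IsSchreierFamily 𝓕 →
      N.familyNorm 𝓔 x ^ 2 + N.familyNorm 𝓕 y ^ 2 ≤ ‖x + y‖ ^ 2 := by
    intro 𝓔 𝓕 h𝓔 h𝓕
    let f : Finset ℕ → Finset ℕ := fun E => E.filter fun p => x p ≠ 0
    let g : Finset ℕ → Finset ℕ := fun E => E.filter fun p => y p ≠ 0
    have hf : ∀ E, f E ⊆ E := fun E => Finset.filter_subset _ _
    have hg : ∀ E, g E ⊆ E := fun E => Finset.filter_subset _ _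
    have hfg : ∀ E F, Disjoint (f E) (g F) := fun E F => by
      refine Finset.disjoint_left.mpr fun p hp hq => ?_
      rcases h p with h0 | h0
      · exact (Finset.mem_filter.mp hp).2 h0
      · exact (Finset.mem_filter.mp hq).2 h0
    have hdf : (𝓔 : Set (Finset ℕ)).PairwiseDisjoint f := fun E hE F hF hEF =>
      (h𝓔.disjoint hE hF hEF).mono (hf E) (hf F)
    have hdg : (𝓕 : Set (Finset ℕ)).PairwiseDisjoint g := fun E hE F hF hEF =>
      (h𝓕.disjoint hE hF hEF).mono (hg E) (hg F)
    set 𝓐 := (𝓔.image f).erase ∅ with h𝓐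
    set 𝓑 := 𝓕.image g
    have hAB : Disjoint 𝓐 𝓑 := by
      refine Finset.disjoint_left.mpr fun A hA hB => ?_
      obtain ⟨hA0, hA1⟩ := Finset.mem_erase.mp hA
      obtain ⟨E, -, rfl⟩ := Finset.mem_image.mp hA1
      obtain ⟨F, -, hF⟩ := Finset.mem_image.mp hB
      have := hfg E F
      rw [hF, disjoint_self] at this
      exact hA0 this
    have hfam : IsSchreierFamily (𝓐 ∪ 𝓑) := by
      constructor
      · rw [Finset.coe_union, Set.pairwiseDisjoint_union]
        refine ⟨?_, ?_, ?_⟩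
        · intro A hA B hB hne
          obtain ⟨E, hE, rfl⟩ := Finset.mem_image.mp (Finset.mem_of_mem_erase hA)
          obtain ⟨F, hF, rfl⟩ := Finset.mem_image.mp (Finset.mem_of_mem_erase hB)
          exact hdf hE hF fun e => hne (by rw [e])
        · intro A hA B hB hne
          obtain ⟨E, hE, rfl⟩ := Finset.mem_image.mp hA
          obtain ⟨F, hF, rfl⟩ := Finset.mem_image.mp hB
          exact hdg hE hF fun e => hne (by rw [e])
        · intro A hA B hB _
          obtain ⟨E, hE, rfl⟩ := Finset.mem_image.mp (Finset.mem_of_mem_erase hA)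
          obtain ⟨F, hF, rfl⟩ := Finset.mem_image.mp hB
          exact hfg E F
      · intro A hA i hi
        rcases Finset.mem_union.mp hA with hA | hA
        · obtain ⟨E, hE, rfl⟩ := Finset.mem_image.mp (Finset.mem_of_mem_erase hA)
          exact (Finset.card_le_card (hf E)).trans (h𝓔.card_le E hE i (hf E hi))
        · obtain ⟨E, hE, rfl⟩ := Finset.mem_image.mp hA
          exact (Finset.card_le_card (hg E)).trans (h𝓕.card_le E hE i (hg E hi))
    have e0 : N (restr (x + y : N.Space) ∅) ^ 2 = 0 := by
      rw [restr_empty, N.zero_eq]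
      norm_num
    have e1 : N.familyNorm 𝓔 x ^ 2 = ∑ A ∈ 𝓐, N (restr (x + y : N.Space) A) ^ 2 := by
      rw [h𝓐, Finset.sum_erase (f := fun A => N (restr (x + y : N.Space) A) ^ 2) _ e0,
        familyNorm_sq,
        Finset.sum_image_of_disjoint (g := fun A => N (restr (x + y : N.Space) A) ^ 2) e0 hdf]
      refine Finset.sum_congr rfl fun E _ => ?_
      congr 2
      ext p
      simp only [restr_apply, f, Finset.mem_filter]
      by_cases hp : x p = 0
      · simp [hp]
      · simp [hp, (h p).resolve_left hp]
    have e2 : N.familyNorm 𝓕 y ^ 2 = ∑ A ∈ 𝓑, N (restr (x + y : N.Space) A) ^ 2 := by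
      rw [familyNorm_sq,
        Finset.sum_image_of_disjoint (g := fun A => N (restr (x + y : N.Space) A) ^ 2) e0 hdg]
      refine Finset.sum_congr rfl fun E _ => ?_
      congr 2
      ext p
      simp only [restr_apply, g, Finset.mem_filter]
      by_cases hp : y p = 0
      · simp [hp]
      · simp [hp, (h p).resolve_right hp]
    rw [e1, e2, ← Finset.sum_union hAB, ← familyNorm_sq]
    exact pow_le_pow_left₀ (N.familyNorm_nonneg _ _) ((x + y).familyNorm_le hfam) 2
  have k1 : ∀ 𝓕, IsSchreierFamily 𝓕 → ‖x‖ ≤ √(‖x + y‖ ^ 2 - N.familyNorm 𝓕 y ^ 2) :=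
    fun 𝓕 h𝓕 => norm_le fun 𝓔 h𝓔 => Real.le_sqrt_of_sq_le (by linarith [key 𝓔 𝓕 h𝓔 h𝓕])
  have k2 : ‖y‖ ≤ √(‖x + y‖ ^ 2 - ‖x‖ ^ 2) := norm_le fun 𝓕 h𝓕 => by
    refine Real.le_sqrt_of_sq_le ?_
    have h1 := pow_le_pow_left₀ (norm_nonneg x) (k1 𝓕 h𝓕) 2
    rw [Real.sq_sqrt] at h1
    · linarith
    · have := key ∅ 𝓕 IsSchreierFamily.empty h𝓕
      nlinarith [sq_nonneg (N.familyNorm ∅ x)]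
  have h1 := pow_le_pow_left₀ (norm_nonneg y) k2 2
  rw [Real.sq_sqrt] at h1
  · linarith
  · have := k1 ∅ IsSchreierFamily.empty
    have h2 := pow_le_pow_left₀ (norm_nonneg x) this 2
    rw [Real.sq_sqrt] at h2
    · nlinarith [sq_nonneg (N.familyNorm ∅ y)]
    · have := key ∅ ∅ IsSchreierFamily.empty IsSchreierFamily.empty
      nlinarith [sq_nonneg (N.familyNorm ∅ x)]

/-- Finitely supported sequences as elements of the space. -/
noncomputable def ofFinsupp (N : TensorNorm) : (ℕ →₀ ℝ) →ₗ[ℝ] N.Space where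
  toFun c := ⟨c, N c, fun _ h => N.familyNorm_finsupp_le h c⟩
  map_add' a b := by
    ext p
    rfl
  map_smul' t a := by
    ext p
    rfl

@[simp] theorem ofFinsupp_apply (c : ℕ →₀ ℝ) (p : ℕ) : ofFinsupp N c p = c p := rfl

theorem norm_ofFinsupp_le (c : ℕ →₀ ℝ) : ‖ofFinsupp N c‖ ≤ N c :=
  norm_le fun _ h => N.familyNorm_finsupp_le h c

theorem norm_ofFinsupp {c : ℕ →₀ ℝ} (h : ∀ i ∈ c.support, c.support.card ≤ i + 1) :
    ‖ofFinsupp N c‖ = N c := by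
  refine le_antisymm (norm_ofFinsupp_le c) ?_
  have := restr_le (ofFinsupp N c) h
  rwa [show restr (ofFinsupp N c) c.support = c from
    restr_of_support_subset (Finset.Subset.refl _)] at this

/-- The initial projections converge pointwise to the identity. -/
theorem tendsto_restr (x : N.Space) :
    Tendsto (fun n => ofFinsupp N (restr x (Finset.range n))) atTop (𝓝 x) := by
  classical
  rw [tendsto_iff_norm_sub_tendsto_zero]
  rw [Metric.tendsto_atTop]
  intro ε hε
  have hlt : √(‖x‖ ^ 2 - ε ^ 2) < ‖x‖ ∨ ‖x‖ = 0 := by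
    rcases (norm_nonneg x).eq_or_lt with h | h
    · exact Or.inr h.symm
    · refine Or.inl ((Real.sqrt_lt' h).mpr ?_)
      have := pow_pos hε 2
      linarith
  rcases hlt with hlt | h0
  · obtain ⟨𝓔, h𝓔⟩ := exists_lt_of_lt_ciSup hlt
    obtain ⟨M, hM⟩ : ∃ M, 𝓔.1.biUnion id ⊆ Finset.range M :=
      ⟨(𝓔.1.biUnion id).sup id + 1, fun p hp => Finset.mem_range.mpr
        (Nat.lt_succ_of_le (Finset.le_sup (f := id) hp))⟩
    refine ⟨M, fun n hn => ?_⟩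
    set u := ofFinsupp N (restr x (Finset.range n)) with hu
    have h1 := norm_sq_add_le (x := u) (y := x - u) fun p => by
      simp only [hu, sub_apply, ofFinsupp_apply, restr_apply]
      split_ifs <;> simp
    have h2 : N.familyNorm 𝓔.1 x ≤ ‖u‖ := by
      refine le_of_eq_of_le ?_ (u.familyNorm_le 𝓔.2)
      refine congrArg Real.sqrt (Finset.sum_congr rfl fun E hE => ?_)
      rw [restr_congr (y := u) fun p hp => ?_]
      have : p ∈ Finset.range n := Finset.mem_range.mpr (lt_of_lt_of_le
        (Finset.mem_range.mp (hM (Finset.mem_biUnion.mpr ⟨E, hE, hp⟩))) hn)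
      rw [hu, ofFinsupp_apply, restr_apply_mem this]
    have h3 := Real.lt_sq_of_sqrt_lt (h𝓔.trans_le h2)
    rw [add_sub_cancel] at h1
    rw [Real.dist_eq, sub_zero, abs_of_nonneg (norm_nonneg _), norm_sub_rev]
    refine abs_lt_of_sq_lt_sq' ?_ hε.le |>.2
    linarith
  · rw [norm_eq_zero] at h0
    subst h0
    refine ⟨0, fun n _ => ?_⟩
    have : ofFinsupp N (restr (0 : N.Space) (Finset.range n)) - 0 = 0 := by
      ext p
      simp [restr_apply]
    rw [this]
    simpa using hε

end Space

end TensorNorm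

namespace TensorNorm

variable {N : TensorNorm}

theorem tendsto_familyNorm {ι : Type*} {l : Filter ι} (𝓔 : Finset (Finset ℕ)) {z : ι → ℕ → ℝ}
    (h : ∀ p, Tendsto (fun m => z m p) l (𝓝 0)) :
    Tendsto (fun m => N.familyNorm 𝓔 (z m)) l (𝓝 0) := by
  have h1 : ∀ E, Tendsto (fun m => N (restr (z m) E)) l (𝓝 0) := by
    intro E
    have h2 : Tendsto (fun m => N.unit * ∑ p ∈ E, |z m p|) l (𝓝 0) := by
      simpa using (tendsto_finsetSum E fun p _ => (h p).abs).const_mul N.unit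
    exact squeeze_zero (fun m => N.nonneg _) (fun m => N.restr_le_sum (z m) E) h2
  have h3 : Tendsto (fun m => ∑ E ∈ 𝓔, N (restr (z m) E) ^ 2) l (𝓝 0) := by
    simpa using tendsto_finsetSum 𝓔 fun E _ => (h1 E).pow 2
  simpa [familyNorm] using h3.sqrt

namespace Space

instance : CompleteSpace N.Space := by
  refine Metric.complete_of_cauchySeq_tendsto fun u hu => ?_
  have hc : ∀ p, ∃ y, Tendsto (fun n => u n p) atTop (𝓝 y) := fun p =>
    cauchySeq_tendsto_of_complete (hu.map (coord N p).uniformContinuous)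
  choose y hy using hc
  have key : ∀ ε > 0, ∃ n₀, ∀ n ≥ n₀, ∀ 𝓔, IsSchreierFamily 𝓔 →
      N.familyNorm 𝓔 ((u n : ℕ → ℝ) - y) ≤ ε := by
    intro ε hε
    obtain ⟨n₀, hn₀⟩ := Metric.cauchySeq_iff.mp hu ε hε
    refine ⟨n₀, fun n hn 𝓔 h𝓔 => ?_⟩
    have h0 : Tendsto (fun m => ε + N.familyNorm 𝓔 ((u m : ℕ → ℝ) - y)) atTop (𝓝 (ε + 0)) :=
      (tendsto_familyNorm 𝓔 fun p => by simpa using (hy p).sub_const (y p)).const_add ε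
    rw [add_zero] at h0
    refine ge_of_tendsto h0 ?_
    filter_upwards [eventually_ge_atTop n₀] with m hm
    have h1 : (u n : ℕ → ℝ) - y = (u n - u m : N.Space) + ((u m : ℕ → ℝ) - y) := by
      ext p
      simp
    rw [h1]
    refine (N.familyNorm_add_le _ _ _).trans (add_le_add ?_ le_rfl)
    refine (familyNorm_le _ h𝓔).trans ?_
    rw [← dist_eq_norm]
    exact (hn₀ n hn m hm).le
  obtain ⟨n₁, hn₁⟩ := key 1 one_pos
  let z : N.Space := ⟨y, ‖u n₁‖ + 1, fun 𝓔 h𝓔 => by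
    have h1 : y = (u n₁ : ℕ → ℝ) + (-1 : ℝ) • ((u n₁ : ℕ → ℝ) - y) := by
      ext p
      simp
    rw [h1]
    refine (N.familyNorm_add_le _ _ _).trans (add_le_add ((u n₁).familyNorm_le h𝓔) ?_)
    rw [N.familyNorm_smul]
    simpa using hn₁ n₁ le_rfl 𝓔 h𝓔⟩
  refine ⟨z, Metric.tendsto_atTop.mpr fun ε hε => ?_⟩
  obtain ⟨n₀, hn₀⟩ := key (ε / 2) (by positivity)
  refine ⟨n₀, fun n hn => ?_⟩
  rw [dist_eq_norm]
  refine lt_of_le_of_lt (norm_le fun 𝓔 h𝓔 => ?_) (half_lt_self hε)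
  exact hn₀ n hn 𝓔 h𝓔

/-- The unit vectors. -/
noncomputable def e (N : TensorNorm) (p : ℕ) : N.Space := ofFinsupp N (Finsupp.single p 1)

theorem e_apply (p q : ℕ) : e N p q = if p = q then 1 else 0 := by
  rw [e, ofFinsupp_apply, Finsupp.single_apply]

theorem ofFinsupp_restr (x : ℕ → ℝ) (E : Finset ℕ) :
    ofFinsupp N (restr x E) = ∑ p ∈ E, x p • e N p := by
  rw [restr_eq_sum, map_sum]
  refine Finset.sum_congr rfl fun p _ => ?_
  rw [e, ← map_smul]
  simp

theorem norm_e (p : ℕ) : ‖e N p‖ = N.unit := by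
  rw [e, norm_ofFinsupp, N.single_one]
  intro i _
  exact (Finset.card_le_card Finsupp.support_single_subset).trans (by simp)

instance : TopologicalSpace.SeparableSpace N.Space := by
  have h : TopologicalSpace.IsSeparable
      (closure (Submodule.span ℝ (Set.range (e N)) : Set N.Space)) :=
    (Set.countable_range (e N)).isSeparable.span.closure
  rw [← TopologicalSpace.isSeparable_univ_iff]
  refine h.mono fun x _ => ?_
  refine mem_closure_of_tendsto x.tendsto_restr (Eventually.of_forall fun n => ?_)
  rw [ofFinsupp_restr]
  exact Submodule.sum_mem _ fun p _ => Submodule.smul_mem _ _ (Submodule.subset_span ⟨p, rfl⟩)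

/-- If the support of `u` lies in an initial interval and `v` has small coordinates, then `u` and `v`
satisfy an upper `2`-estimate up to a small error. -/
theorem norm_add_le_of_abs_le {u v : N.Space} {M : ℕ} {η : ℝ} (hu : ∀ p, M ≤ p → u p = 0)
    (hη : ∀ p, |v p| ≤ η) :
    ‖u + v‖ ≤ √(‖u‖ ^ 2 + ‖v‖ ^ 2) + M * (N.unit * (M * η)) := by
  classical
  have hη0 : 0 ≤ η := (abs_nonneg _).trans (hη 0)
  have hκ := N.unit_pos
  refine norm_le fun 𝓔 h𝓔 => ?_
  set δ : ℝ := N.unit * (M * η)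
  have hδ : 0 ≤ δ := by positivity
  let P : Finset ℕ → Prop := fun E => ∃ i ∈ E, i < M
  have h := sqrt_sum_sq_le_add 𝓔 (f := fun E => N (restr (u + v : N.Space) E))
    (g := fun E => if P E then N (restr u E) else N (restr v E))
    (h := fun E => if P E then δ else 0) (fun _ _ => N.nonneg _)
    (fun E _ => by split_ifs <;> exact N.nonneg _)
    (fun E _ => by split_ifs; exacts [hδ, le_rfl]) fun E hE => by
      split_ifs with hP
      · obtain ⟨i, hi, hiM⟩ := hP
        rw [coe_add, restr_add]
        refine (N.add_le _ _).trans (add_le_add le_rfl ((N.restr_le_sum v E).trans ?_))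
        refine mul_le_mul_of_nonneg_left ?_ hκ.le
        refine (Finset.sum_le_card_nsmul E _ η fun p _ => hη p).trans ?_
        rw [nsmul_eq_mul]
        refine mul_le_mul_of_nonneg_right ?_ hη0
        exact_mod_cast (h𝓔.card_le E hE i hi).trans hiM
      · rw [add_zero, restr_congr (y := v) fun p hp => ?_]
        have hp' : M ≤ p := not_lt.mp fun hlt => hP ⟨p, hp, hlt⟩
        rw [add_apply, hu p hp', zero_add]
  refine h.trans (add_le_add (Real.sqrt_le_sqrt ?_) ?_)
  · simp only [ite_pow]
    rw [Finset.sum_ite]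
    refine add_le_add ?_ ?_
    · rw [← familyNorm_sq]
      exact pow_le_pow_left₀ (N.familyNorm_nonneg _ _)
        (u.familyNorm_le (h𝓔.mono (Finset.filter_subset _ _))) 2
    · rw [← familyNorm_sq]
      exact pow_le_pow_left₀ (N.familyNorm_nonneg _ _)
        (v.familyNorm_le (h𝓔.mono (Finset.filter_subset _ _))) 2
  · simp only [ite_pow]
    rw [Finset.sum_ite, Finset.sum_const, nsmul_eq_mul, zero_pow (two_ne_zero (α := ℕ)),
      Finset.sum_const_zero, add_zero]
    refine Real.sqrt_le_iff.mpr ⟨by positivity, ?_⟩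
    have h1 : (𝓔.filter P).card ≤ M ^ 2 :=
      (h𝓔.card_filter_le M).trans (Nat.le_self_pow two_ne_zero M)
    have h2 : ((𝓔.filter P).card : ℝ) ≤ (M : ℝ) ^ 2 := by exact_mod_cast h1
    rw [mul_pow (M : ℝ) δ]
    exact mul_le_mul_of_nonneg_right h2 (sq_nonneg δ)

end Space

end TensorNorm

namespace TensorNorm

namespace Space

variable {N : TensorNorm}

theorem sum_sq_le_norm_sq (x : N.Space) (F : Finset ℕ) : ∑ p ∈ F, x p ^ 2 ≤ ‖x‖ ^ 2 := by
  classical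
  have hF : IsSchreierFamily (F.image singleton) := by
    constructor
    · intro A hA B hB hAB
      obtain ⟨p, -, rfl⟩ : ∃ p ∈ F, {p} = A := by simpa using hA
      obtain ⟨q, -, rfl⟩ : ∃ q ∈ F, {q} = B := by simpa using hB
      exact Finset.disjoint_singleton.mpr fun h => hAB (by rw [h])
    · intro A hA
      obtain ⟨p, -, rfl⟩ : ∃ p ∈ F, {p} = A := by simpa using hA
      simp
  refine le_trans ?_ (pow_le_pow_left₀ (N.familyNorm_nonneg _ _) (x.familyNorm_le hF) 2)
  rw [familyNorm_sq, Finset.sum_image (by simp)]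
  refine Finset.sum_le_sum fun p _ => ?_
  rw [← sq_abs]
  exact pow_le_pow_left₀ (abs_nonneg _) (N.abs_le_restr x (Finset.mem_singleton_self p)) 2

/-- The positions where the coordinates of `x` have dyadic size `2⁻ᵗ`. -/
def level (x : N.Space) (t : ℕ) : Set ℕ :=
  {p | (1 / 2 : ℝ) ^ (t + 1) < |x p| ∧ |x p| ≤ (1 / 2 : ℝ) ^ t}

theorem card_le_of_subset_level {x : N.Space} (hx : ‖x‖ ≤ 1) {t : ℕ} {F : Finset ℕ}
    (hF : (F : Set ℕ) ⊆ x.level t) : F.card ≤ 4 ^ (t + 1) := by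
  have h1 : ∑ p ∈ F, ((1 / 2 : ℝ) ^ (t + 1)) ^ 2 ≤ 1 := by
    refine (Finset.sum_le_sum fun p hp => ?_).trans
      ((x.sum_sq_le_norm_sq F).trans (pow_le_one₀ (norm_nonneg x) hx))
    rw [← sq_abs (x p)]
    exact pow_le_pow_left₀ (by positivity) (hF hp).1.le 2
  rw [Finset.sum_const, nsmul_eq_mul, ← pow_mul, mul_comm (t + 1) 2, pow_mul] at h1
  have h2 : ((1 / 2 : ℝ) ^ 2) ^ (t + 1) * 4 ^ (t + 1) = 1 := by
    rw [← mul_pow]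
    norm_num
  have h3 : (F.card : ℝ) ≤ 4 ^ (t + 1) := by
    calc (F.card : ℝ) = F.card * ((1 / 2 : ℝ) ^ 2) ^ (t + 1) * 4 ^ (t + 1) := by
          rw [mul_assoc, h2, mul_one]
      _ ≤ 1 * 4 ^ (t + 1) := by gcongr
      _ = _ := one_mul _
  exact_mod_cast h3

theorem level_finite {x : N.Space} (hx : ‖x‖ ≤ 1) (t : ℕ) : (x.level t).Finite := by
  by_contra h
  obtain ⟨F, hF, hc⟩ := Set.Infinite.exists_subset_card_eq h (4 ^ (t + 1) + 1)
  have := card_le_of_subset_level hx hF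
  omega

theorem ncard_level_le {x : N.Space} (hx : ‖x‖ ≤ 1) (t : ℕ) :
    (x.level t).ncard ≤ 4 ^ (t + 1) := by
  rw [Set.ncard_eq_toFinset_card _ (level_finite hx t)]
  exact card_le_of_subset_level hx (by simp)

theorem level_unique {x : N.Space} {s t p : ℕ} (hs : p ∈ x.level s) (ht : p ∈ x.level t) :
    s = t := by
  by_contra hne
  wlog h : s < t generalizing s t
  · exact this ht hs (Ne.symm hne) (by omega)
  have h1 : (1 / 2 : ℝ) ^ t ≤ (1 / 2) ^ (s + 1) :=
    pow_le_pow_of_le_one (by norm_num) (by norm_num) h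
  linarith [hs.1, ht.2]

theorem exists_mem_level {x : N.Space} (hx : ‖x‖ ≤ 1) {p : ℕ} (hp : x p ≠ 0) :
    ∃ t, p ∈ x.level t :=
  exists_nat_pow_near_of_lt_one (abs_pos.mpr hp) ((x.abs_apply_le p).trans hx)
    (by norm_num) (by norm_num)

theorem exists_bijOn_level {x : N.Space} (hx : ‖x‖ ≤ 1) (t : ℕ) :
    ∃ r : ℕ → ℕ, Set.BijOn r (x.level t) (Set.Iio (x.level t).ncard) := by
  refine (level_finite hx t).exists_bijOn_of_encard_eq ?_
  rw [← (level_finite hx t).cast_ncard_eq, ← (Set.finite_Iio _).cast_ncard_eq]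
  congr 1
  rw [← Finset.coe_range, Set.ncard_coe_finset, Finset.card_range]

/-- The limiting distribution of the large coordinates of a bounded coordinatewise null sequence
along an ultrafilter. -/
theorem exists_profile (U : Ultrafilter ℕ) (x : ℕ → N.Space) (hx : ∀ k, ‖x k‖ ≤ 1)
    (h0 : ∀ p, Tendsto (fun k => x k p) U (𝓝 0)) :
    ∃ b : ℕ → ℝ, (∀ F, N (restr b F) ≤ 2) ∧
      ((∀ ε > 0, ∀ᶠ k in U, ∀ p, |x k p| ≤ ε) → b = 0) ∧
      ∀ η > 0, ∀ᶠ k in U, ∃ τ : ℕ → ℕ, Set.InjOn τ {p | η < |x k p|} ∧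
        ∀ p, η < |x k p| → |x k p| ≤ |b (τ p)| := by
  classical
  have hm : ∀ t, ∃ m, ∀ᶠ k in U, ((x k).level t).ncard = m := by
    intro t
    have := (Ultrafilter.eventually_exists_mem_iff (f := U) (is := Set.Iic (4 ^ (t + 1)))
      (P := fun m k => ((x k).level t).ncard = m) (Set.finite_Iic _)).mp
      (Eventually.of_forall fun k => ⟨_, ncard_level_le (hx k) t, rfl⟩)
    obtain ⟨m, -, h⟩ := this
    exact ⟨m, h⟩
  choose m hm using hm
  have hmT : ∀ T, ∀ᶠ k in U, ∀ t < T, ((x k).level t).ncard = m t := fun T =>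
    (Set.finite_Iio T).eventually_all.mpr fun t _ => hm t
  choose r hr using fun k t => exists_bijOn_level (hx k) t
  refine ⟨fun q => if q.unpair.2 < m q.unpair.1 then (1 / 2) ^ q.unpair.1 else 0,
    fun F => ?_, fun h => ?_, fun η hη => ?_⟩
  · set b : ℕ → ℝ := fun q => if q.unpair.2 < m q.unpair.1 then (1 / 2) ^ q.unpair.1 else 0
    obtain ⟨T, hT⟩ : ∃ T, ∀ q ∈ F, q.unpair.1 < T :=
      ⟨F.sup (fun q => q.unpair.1) + 1, fun q hq =>
        Nat.lt_succ_of_le (Finset.le_sup (f := fun q => q.unpair.1) hq)⟩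
    set R := ∑ t ∈ Finset.range T, m t
    have hsmall : ∀ᶠ k in U, ∀ p < R, |x k p| < (1 / 2) ^ T :=
      (Set.finite_Iio R).eventually_all.mpr fun p _ =>
        (by simpa using (h0 p).abs : Tendsto (fun k => |x k p|) U (𝓝 0)).eventually_lt_const
          (by positivity)
    obtain ⟨k, hk1, hk2⟩ := ((hmT T).and hsmall).exists
    let B : Finset ℕ := (Finset.range T).biUnion fun t => (level_finite (hx k) t).toFinset
    have hBmem : ∀ p, p ∈ B ↔ ∃ t < T, p ∈ (x k).level t := fun p => by simp [B]
    have hBcard : B.card ≤ R := by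
      refine Finset.card_biUnion_le.trans (Finset.sum_le_sum fun t ht => le_of_eq ?_)
      rw [← Set.ncard_eq_toFinset_card _ (level_finite (hx k) t)]
      exact hk1 t (Finset.mem_range.mp ht)
    have hB : ∀ p ∈ B, B.card ≤ p + 1 := by
      intro p hp
      obtain ⟨t, ht, hpt⟩ := (hBmem p).mp hp
      have : R ≤ p := by
        by_contra hlt
        have h1 := hk2 p (not_le.mp hlt)
        have h2 : (1 / 2 : ℝ) ^ T ≤ (1 / 2) ^ (t + 1) :=
          pow_le_pow_of_le_one (by norm_num) (by norm_num) ht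
        linarith [hpt.1]
      omega
    have hσ : ∀ q, q ∈ F → q.unpair.2 < m q.unpair.1 →
        ∃ p, p ∈ (x k).level q.unpair.1 ∧ r k q.unpair.1 p = q.unpair.2 := by
      intro q hq hlt
      obtain ⟨p, hp, hpr⟩ := (hr k q.unpair.1).surjOn (a := q.unpair.2)
        (by rw [hk1 _ (hT q hq)]; exact hlt)
      exact ⟨p, hp, hpr⟩
    choose! σ hσ1 hσ2 using hσ
    have hsupp : ∀ q ∈ (restr b F).support, q ∈ F ∧ q.unpair.2 < m q.unpair.1 := by
      intro q hq
      have hqF := support_restr_subset b F hq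
      refine ⟨hqF, ?_⟩
      by_contra hlt
      rw [Finsupp.mem_support_iff, restr_apply_mem hqF] at hq
      exact hq (if_neg hlt)
    calc N (restr b F) ≤ N (restr ((2 : ℝ) • (x k : ℕ → ℝ)) B) := by
          refine N.dominated _ _ σ ?_ fun q => ?_
          · intro q hq q' hq' heq
            obtain ⟨h1, h2⟩ := hsupp q hq
            obtain ⟨h1', h2'⟩ := hsupp q' hq'
            have e1 : q.unpair.1 = q'.unpair.1 := by
              have := hσ1 q' h1' h2'
              rw [← heq] at this
              exact level_unique (hσ1 q h1 h2) this
            have e2 : q.unpair.2 = q'.unpair.2 := by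
              rw [← hσ2 q h1 h2, ← hσ2 q' h1' h2', heq, e1]
            rw [← Nat.pair_unpair q, ← Nat.pair_unpair q', e1, e2]
          · by_cases hq : q ∈ (restr b F).support
            · obtain ⟨h1, h2⟩ := hsupp q hq
              have h3 := hσ1 q h1 h2
              rw [restr_apply_mem h1, restr_apply_mem ((hBmem _).mpr ⟨_, hT q h1, h3⟩)]
              have h4 : b q = (1 / 2) ^ q.unpair.1 := if_pos h2
              rw [h4, abs_of_nonneg (by positivity), Pi.smul_apply, smul_eq_mul, abs_mul]
              have := h3.1
              rw [pow_succ] at this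
              rw [abs_two]
              linarith
            · rw [Finsupp.notMem_support_iff.mp hq, abs_zero]
              exact abs_nonneg _
      _ = 2 * N (restr (x k) B) := by rw [restr_smul, N.smul_eq, abs_two]
      _ ≤ 2 * 1 := by
          gcongr
          exact ((x k).restr_le hB).trans (hx k)
      _ = 2 := by norm_num
  · have hm0 : ∀ t, m t = 0 := by
      intro t
      obtain ⟨k, hk1, hk2⟩ := ((hm t).and (h ((1 / 2) ^ (t + 1)) (by positivity))).exists
      rw [← hk1, Set.ncard_eq_zero (level_finite (hx k) t)]
      ext p
      simp only [Set.mem_empty_iff_false, iff_false]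
      intro hp
      exact absurd (hk2 p) (not_le.mpr hp.1)
    funext q
    simp [hm0]
  · obtain ⟨T, hT⟩ := exists_pow_lt_of_lt_one hη (by norm_num : (1 / 2 : ℝ) < 1)
    filter_upwards [hmT T] with k hk
    have hlev : ∀ p, η < |x k p| → ∃ t, p ∈ (x k).level t := fun p hp =>
      exists_mem_level (hx k) (abs_pos.mp (hη.trans hp))
    choose! s hs using hlev
    have hsT : ∀ p, η < |x k p| → s p < T := by
      intro p hp
      by_contra hlt
      have h1 : (1 / 2 : ℝ) ^ (s p) ≤ (1 / 2) ^ T :=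
        pow_le_pow_of_le_one (by norm_num) (by norm_num) (not_lt.mp hlt)
      linarith [(hs p hp).2]
    refine ⟨fun p => Nat.pair (s p) (r k (s p) p), fun p hp q hq hpq => ?_, fun p hp => ?_⟩
    · obtain ⟨h1, h2⟩ := Nat.pair_eq_pair.mp hpq
      rw [← h1] at h2
      have h3 := hs q hq
      rw [← h1] at h3
      exact (hr k (s p)).injOn (hs p hp) h3 h2
    · have h1 : r k (s p) p < m (s p) := by
        rw [← hk _ (hsT p hp)]
        exact (hr k (s p)).mapsTo (hs p hp)
      simp only [Nat.unpair_pair, if_pos h1]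
      rw [abs_of_nonneg (by positivity : (0 : ℝ) ≤ (1 / 2) ^ s p)]
      exact (hs p hp).2

end Space

end TensorNorm

namespace TensorNorm

namespace Space

/-- The terms `x (k j)` are concentrated on the intervals `[M j, M (j + 1))`, up to an error `δ`,
and the coordinates of `x (k j)` that exceed `η (M j)` are dominated by the profile `b`. -/
structure IsBlocked {N : TensorNorm} (x : ℕ → N.Space) (b : ℕ → ℝ) (δ : ℝ) (η : ℕ → ℝ)
    (k M : ℕ → ℕ) : Prop where
  approx : ∀ j, ‖x (k j) - ofFinsupp N (restr (x (k j)) (Finset.Ico (M j) (M (j + 1))))‖ ≤ δ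
  fit : ∀ j, ∃ τ : ℕ → ℕ, Set.InjOn τ {p | η (M j) < |x (k j) p|} ∧
    ∀ p, η (M j) < |x (k j) p| → |x (k j) p| ≤ |b (τ p)|

theorem exists_isBlocked {ι : Type*} [Finite ι] {N : ι → TensorNorm} (U : Ultrafilter ℕ)
    (hU : (U : Filter ℕ) ≤ atTop) (x : ∀ i, ℕ → (N i).Space)
    (h0 : ∀ i p, Tendsto (fun k => x i k p) U (𝓝 0)) (b : ι → ℕ → ℝ)
    (hb : ∀ i, ∀ η > 0, ∀ᶠ k in U, ∃ τ : ℕ → ℕ, Set.InjOn τ {p | η < |x i k p|} ∧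
        ∀ p, η < |x i k p| → |x i k p| ≤ |b i (τ p)|)
    {Q : ℕ → Prop} (hQ : ∀ᶠ k in U, Q k) (K : ℕ) {δ : ℝ} (hδ : 0 < δ) {η : ℕ → ℝ}
    (hη : ∀ M, 0 < η M) :
    ∃ k M : ℕ → ℕ, StrictMono k ∧ StrictMono M ∧ (∀ j, K ≤ k j) ∧ (∀ j, K ≤ M j) ∧
      (∀ j, Q (k j)) ∧ ∀ i, IsBlocked (x i) (b i) δ η k M := by
  classical
  have step : ∀ s : ℕ × ℕ, ∃ t : ℕ × ℕ, s.1 < t.1 ∧ s.2 < t.2 ∧ Q t.1 ∧ ∀ i,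
      ‖x i t.1 - ofFinsupp (N i) (restr (x i t.1) (Finset.Ico s.2 t.2))‖ ≤ δ ∧
      ∃ τ : ℕ → ℕ, Set.InjOn τ {p | η s.2 < |x i t.1 p|} ∧
        ∀ p, η s.2 < |x i t.1 p| → |x i t.1 p| ≤ |b i (τ p)| := by
    rintro ⟨n, M⟩
    have hhead : ∀ i, ∀ᶠ k in U, ‖ofFinsupp (N i) (restr (x i k) (Finset.range M))‖ < δ / 2 := by
      intro i
      have h1 : Tendsto (fun k => (N i).unit * ∑ p ∈ Finset.range M, |x i k p|) U (𝓝 0) := by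
        simpa using (tendsto_finsetSum (Finset.range M) fun p _ => (h0 i p).abs).const_mul
          (N i).unit
      filter_upwards [h1.eventually_lt_const (half_pos hδ)] with k hk
      exact ((norm_ofFinsupp_le _).trans ((N i).restr_le_sum _ _)).trans_lt hk
    obtain ⟨k, hk1, hk2, hk3, hk4⟩ := (((eventually_gt_atTop n).filter_mono hU).and (hQ.and
      ((eventually_all.mpr hhead).and (eventually_all.mpr fun i => hb i _ (hη M))))).exists
    have htail : ∀ i, ∀ᶠ M' in atTop,
        ‖ofFinsupp (N i) (restr (x i k) (Finset.range M')) - x i k‖ < δ / 2 := fun i =>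
      (tendsto_iff_norm_sub_tendsto_zero.mp (x i k).tendsto_restr).eventually_lt_const
        (half_pos hδ)
    obtain ⟨M', hM1, hM2⟩ := ((eventually_gt_atTop M).and (eventually_all.mpr htail)).exists
    refine ⟨(k, M'), hk1, hM1, hk2, fun i => ⟨?_, hk4 i⟩⟩
    have e1 : restr (x i k) (Finset.range M') =
        restr (x i k) (Finset.range M) + restr (x i k) (Finset.Ico M M') := by
      rw [← restr_union]
      · congr 1
        ext p
        simp only [Finset.mem_range, Finset.mem_union, Finset.mem_Ico]
        omega
      · rw [Finset.disjoint_left]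
        intro p hp hq
        simp only [Finset.mem_range, Finset.mem_Ico] at hp hq
        omega
    have e2 : x i k - ofFinsupp (N i) (restr (x i k) (Finset.Ico M M')) =
        ofFinsupp (N i) (restr (x i k) (Finset.range M)) -
          (ofFinsupp (N i) (restr (x i k) (Finset.range M')) - x i k) := by
      rw [e1, map_add]
      abel
    rw [e2]
    refine (norm_sub_le _ _).trans ?_
    linarith [hk3 i, hM2 i]
  choose f hf using step
  let s : ℕ → ℕ × ℕ := fun j => Nat.rec (K, K) (fun _ t => f t) j
  have hs : ∀ j, s (j + 1) = f (s j) := fun j => rfl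
  have h1 : StrictMono fun j => (s j).1 := strictMono_nat_of_lt_succ fun j => by
    rw [hs]
    exact (hf (s j)).1
  have h2 : StrictMono fun j => (s j).2 := strictMono_nat_of_lt_succ fun j => by
    rw [hs]
    exact (hf (s j)).2.1
  refine ⟨fun j => (s (j + 1)).1, fun j => (s j).2, fun i j hij => h1 (Nat.succ_lt_succ hij), h2,
    fun j => h1.monotone (Nat.zero_le (j + 1)), fun j => h2.monotone (Nat.zero_le j),
    fun j => ?_, fun i => ⟨fun j => ?_, fun j => ?_⟩⟩
  · simp only [hs]
    exact (hf (s j)).2.2.1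
  · simp only [hs]
    exact ((hf (s j)).2.2.2 i).1
  · simp only [hs]
    exact ((hf (s j)).2.2.2 i).2

theorem mem_Ico_unique {M : ℕ → ℕ} (hM : StrictMono M) {i j p : ℕ}
    (hi : p ∈ Finset.Ico (M i) (M (i + 1))) (hj : p ∈ Finset.Ico (M j) (M (j + 1))) : i = j := by
  rw [Finset.mem_Ico] at hi hj
  by_contra hne
  rcases lt_or_gt_of_ne hne with h | h
  · have := hM.monotone (Nat.succ_le_of_lt h)
    simp only [Nat.succ_eq_add_one] at this
    omega
  · have := hM.monotone (Nat.succ_le_of_lt h)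
    simp only [Nat.succ_eq_add_one] at this
    omega

/-- A sum of restrictions to successive intervals, evaluated at a point of one of them. -/
theorem sum_restr_apply {M : ℕ → ℕ} (hM : StrictMono M) (a : ℕ → ℝ) (v : ℕ → ℕ → ℝ)
    {J : ℕ → Finset ℕ} (hJ : ∀ j, J j ⊆ Finset.Ico (M j) (M (j + 1))) {n j p : ℕ} (hj : j < n)
    (hp : p ∈ Finset.Ico (M j) (M (j + 1))) :
    (∑ i ∈ Finset.range n, a i • restr (v i) (J i)) p = a j * restr (v j) (J j) p := by
  rw [Finsupp.finsetSum_apply, Finset.sum_eq_single_of_mem j (Finset.mem_range.mpr hj)]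
  · rfl
  · intro i _ hij
    rw [Finsupp.smul_apply, restr_apply, if_neg, smul_zero]
    exact fun hi => hij (mem_Ico_unique hM (hJ i hi) hp)

theorem exists_of_sum_restr_ne_zero {a : ℕ → ℝ} {v : ℕ → ℕ → ℝ} {J : ℕ → Finset ℕ} {n p : ℕ}
    (h : (∑ i ∈ Finset.range n, a i • restr (v i) (J i)) p ≠ 0) : ∃ j < n, p ∈ J j := by
  by_contra hne
  push Not at hne
  refine h ?_
  rw [Finsupp.finsetSum_apply]
  refine Finset.sum_eq_zero fun i hi => ?_
  rw [Finsupp.smul_apply, restr_apply, if_neg (hne i (Finset.mem_range.mp hi)), smul_zero]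

namespace IsBlocked

variable {N : TensorNorm} {x : ℕ → N.Space} {b : ℕ → ℝ} {δ : ℝ} {η : ℕ → ℝ} {k M : ℕ → ℕ}
  (h : IsBlocked x b δ η k M) (hM : StrictMono M) {a : ℕ → ℝ} (ha : ∀ j, |a j| ≤ 1)

include h ha in
theorem norm_sum_sub_le (n : ℕ) :
    ‖∑ j ∈ Finset.range n, a j • x (k j) - ofFinsupp N (∑ j ∈ Finset.range n,
      a j • restr (x (k j)) (Finset.Ico (M j) (M (j + 1))))‖ ≤ n * δ := by
  rw [map_sum, ← Finset.sum_sub_distrib]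
  refine (norm_sum_le_of_le (Finset.range n) (f := fun j => a j • x (k j) - ofFinsupp N
    (a j • restr (x (k j)) (Finset.Ico (M j) (M (j + 1))))) (n := fun _ => δ) fun j _ => ?_).trans
      (by simp)
  rw [map_smul, ← smul_sub, norm_smul]
  exact (mul_le_mul (ha j) (h.approx j) (norm_nonneg _) zero_le_one).trans (one_mul δ).le

include h hM in
theorem norm_big_le {β : ℝ} (hβ : ∀ F, N (restr b F) ≤ β) (n : ℕ) :
    N (∑ j ∈ Finset.range n, a j • restr (x (k j))
      ((Finset.Ico (M j) (M (j + 1))).filter fun p => η (M j) < |x (k j) p|)) ≤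
      β * N (restr a (Finset.range n)) := by
  classical
  set J : ℕ → Finset ℕ := fun j =>
    (Finset.Ico (M j) (M (j + 1))).filter fun p => η (M j) < |x (k j) p|
  have hJ : ∀ j, J j ⊆ Finset.Ico (M j) (M (j + 1)) := fun j => Finset.filter_subset _ _
  set Y : ℕ →₀ ℝ := ∑ j ∈ Finset.range n, a j • restr (x (k j)) (J j)
  choose τ hτ1 hτ2 using h.fit
  have hσ : ∀ p, p ∈ Y.support → ∃ j, j < n ∧ p ∈ J j := fun p hp =>
    exists_of_sum_restr_ne_zero (Finsupp.mem_support_iff.mp hp)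
  choose! σ hσ1 hσ2 using hσ
  have hval : ∀ p ∈ Y.support, Y p = a (σ p) * x (k (σ p)) p := fun p hp => by
    rw [← restr_apply_mem (x := x (k (σ p))) (hσ2 p hp)]
    exact sum_restr_apply hM a (fun j => x (k j)) hJ (hσ1 p hp) (hJ _ (hσ2 p hp))
  rw [mul_comm]
  refine (N.tensor Y (restr a (Finset.range n)) (restr b (Y.support.image fun p => τ (σ p) p)) σ
    (fun p => τ (σ p) p) ?_ fun p => ?_).trans (mul_le_mul_of_nonneg_left (hβ _) (N.nonneg _))
  · intro p hp q hq hpq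
    obtain ⟨h1, h2⟩ := Prod.mk.inj hpq
    have hp' := hσ2 p hp
    have hq' := hσ2 q hq
    rw [← h1] at h2 hq'
    exact hτ1 (σ p) (Finset.mem_filter.mp hp').2 (Finset.mem_filter.mp hq').2 h2
  · by_cases hp : p ∈ Y.support
    · rw [hval p hp, abs_mul, restr_apply_mem (Finset.mem_range.mpr (hσ1 p hp)),
        restr_apply_mem (Finset.mem_image_of_mem _ hp)]
      exact mul_le_mul_of_nonneg_left (hτ2 _ p (Finset.mem_filter.mp (hσ2 p hp)).2) (abs_nonneg _)
    · rw [Finsupp.notMem_support_iff.mp hp, abs_zero]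
      positivity

include hM ha in
theorem norm_small_le (hx : ∀ k, ‖x k‖ ≤ 1) (hδ : 0 ≤ δ) (hη0 : ∀ M, 0 < η M)
    (hη : ∀ M : ℕ, M * (N.unit * (M * η M)) ≤ δ) (n : ℕ) :
    ‖ofFinsupp N (∑ j ∈ Finset.range n, a j • restr (x (k j))
      ((Finset.Ico (M j) (M (j + 1))).filter fun p => ¬ η (M j) < |x (k j) p|))‖ ≤
      √(∑ j ∈ Finset.range n, a j ^ 2) + n * δ := by
  set J : ℕ → Finset ℕ := fun j =>
    (Finset.Ico (M j) (M (j + 1))).filter fun p => ¬ η (M j) < |x (k j) p|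
  have hJ : ∀ j, J j ⊆ Finset.Ico (M j) (M (j + 1)) := fun j => Finset.filter_subset _ _
  induction n with
  | zero => simp
  | succ n ih =>
    rw [Finset.sum_range_succ, Finset.sum_range_succ, map_add]
    set u := ofFinsupp N (∑ j ∈ Finset.range n, a j • restr (x (k j)) (J j)) with hu
    set v := ofFinsupp N (a n • restr (x (k n)) (J n)) with hv
    have hvp : ∀ p, |v p| ≤ |a n| * |x (k n) p| := fun p => by
      rw [hv, ofFinsupp_apply, Finsupp.smul_apply, smul_eq_mul, abs_mul, restr_apply]
      refine mul_le_mul_of_nonneg_left ?_ (abs_nonneg _)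
      split_ifs <;> simp
    have h1 : ‖u + v‖ ≤ √(‖u‖ ^ 2 + ‖v‖ ^ 2) + M n * (N.unit * (M n * η (M n))) := by
      refine norm_add_le_of_abs_le (fun p hp => ?_) fun p => ?_
      · by_contra hne
        obtain ⟨j, hj, hpj⟩ := exists_of_sum_restr_ne_zero hne
        have h2 := (Finset.mem_Ico.mp (hJ j hpj)).2
        have h3 : M (j + 1) ≤ M n := hM.monotone hj
        omega
      · rw [hv, ofFinsupp_apply, Finsupp.smul_apply, smul_eq_mul, abs_mul, restr_apply]
        refine (mul_le_of_le_one_left (abs_nonneg _) (ha n)).trans ?_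
        split_ifs with hp
        · exact not_lt.mp (Finset.mem_filter.mp hp).2
        · rw [abs_zero]
          exact (hη0 _).le
    have hvn : ‖v‖ ≤ |a n| := by
      have : ‖v‖ ≤ ‖a n • x (k n)‖ := norm_mono fun p => by
        rw [smul_apply, abs_mul]
        exact hvp p
      rw [norm_smul] at this
      exact this.trans (mul_le_of_le_one_right (abs_nonneg _) (hx _))
    set S := ∑ j ∈ Finset.range n, a j ^ 2
    have hS : 0 ≤ S := Finset.sum_nonneg fun _ _ => sq_nonneg _
    have h4 : √(‖u‖ ^ 2 + ‖v‖ ^ 2) ≤ √(S + a n ^ 2) + n * δ := by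
      refine Real.sqrt_le_iff.mpr ⟨by positivity, ?_⟩
      have h5 := pow_le_pow_left₀ (norm_nonneg u) ih 2
      have h6 := pow_le_pow_left₀ (norm_nonneg v) hvn 2
      have h7 : √S ≤ √(S + a n ^ 2) := Real.sqrt_le_sqrt (by nlinarith [sq_nonneg (a n)])
      have h8 : 0 ≤ (n : ℝ) * δ := by positivity
      rw [sq_abs] at h6
      rw [add_sq, Real.sq_sqrt hS] at h5
      rw [add_sq, Real.sq_sqrt (by positivity)]
      nlinarith [mul_le_mul_of_nonneg_right h7 h8]
    push_cast
    linarith [hη (M n)]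

include h hM ha in
theorem norm_sum_le (hx : ∀ k, ‖x k‖ ≤ 1) (hδ : 0 ≤ δ) (hη0 : ∀ M, 0 < η M)
    (hη : ∀ M : ℕ, M * (N.unit * (M * η M)) ≤ δ) {β : ℝ} (hβ : ∀ F, N (restr b F) ≤ β) (n : ℕ) :
    ‖∑ j ∈ Finset.range n, a j • x (k j)‖ ≤
      √(∑ j ∈ Finset.range n, a j ^ 2) + β * N (restr a (Finset.range n)) + 2 * (n * δ) := by
  classical
  have h1 := h.norm_sum_sub_le ha n
  have h2 := (norm_ofFinsupp_le (N := N) _).trans (h.norm_big_le hM (a := a) hβ n)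
  have h3 := norm_small_le (k := k) hM ha hx hδ hη0 hη n
  have e : ∀ j, restr (x (k j)) (Finset.Ico (M j) (M (j + 1))) =
      restr (x (k j)) ((Finset.Ico (M j) (M (j + 1))).filter fun p => η (M j) < |x (k j) p|) +
      restr (x (k j)) ((Finset.Ico (M j) (M (j + 1))).filter fun p => ¬ η (M j) < |x (k j) p|) :=
    fun j => by
      rw [← restr_union (Finset.disjoint_filter_filter_not _ _ _), Finset.filter_union_filter_not_eq]
  simp only [e, smul_add, Finset.sum_add_distrib, map_add] at h1
  have h4 := norm_le_norm_add_norm_sub' (∑ j ∈ Finset.range n, a j • x (k j)) (ofFinsupp N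
    (∑ j ∈ Finset.range n, a j • restr (x (k j))
      ((Finset.Ico (M j) (M (j + 1))).filter fun p => η (M j) < |x (k j) p|)) +
    ofFinsupp N (∑ j ∈ Finset.range n, a j • restr (x (k j))
      ((Finset.Ico (M j) (M (j + 1))).filter fun p => ¬ η (M j) < |x (k j) p|)))
  linarith [norm_add_le (ofFinsupp N
    (∑ j ∈ Finset.range n, a j • restr (x (k j))
      ((Finset.Ico (M j) (M (j + 1))).filter fun p => η (M j) < |x (k j) p|)))
    (ofFinsupp N (∑ j ∈ Finset.range n, a j • restr (x (k j))
      ((Finset.Ico (M j) (M (j + 1))).filter fun p => ¬ η (M j) < |x (k j) p|)))]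

include h hM ha in
theorem mul_norm_le {ε : ℝ} (hε : δ < ε) (hxε : ∀ j, ∃ p, ε ≤ |x (k j) p|) {n : ℕ}
    (hn : n ≤ M 0) :
    ε * N (restr a (Finset.range n)) ≤ ‖∑ j ∈ Finset.range n, a j • x (k j)‖ + n * δ := by
  classical
  have hδ : 0 ≤ δ := (norm_nonneg _).trans (h.approx 0)
  choose q hq using hxε
  have hqI : ∀ j, q j ∈ Finset.Ico (M j) (M (j + 1)) := by
    intro j
    by_contra hne
    have h1 := (abs_apply_le _ (q j)).trans (h.approx j)
    rw [sub_apply, ofFinsupp_apply, restr_apply, if_neg hne, sub_zero] at h1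
    linarith [hq j]
  have hqinj : Function.Injective q := fun i j hij =>
    mem_Ico_unique hM (hqI i) (by rw [hij]; exact hqI j)
  set S : ℕ →₀ ℝ := ∑ j ∈ Finset.range n, a j • restr (x (k j)) (Finset.Ico (M j) (M (j + 1)))
  have h1 : ε * N (restr a (Finset.range n)) ≤ N (restr S ((Finset.range n).image q)) := by
    have hε0 : 0 ≤ ε := hδ.trans hε.le
    have e : ε * N (restr a (Finset.range n)) = N (ε • restr a (Finset.range n)) := by
      rw [N.smul_eq, abs_of_nonneg hε0]
    rw [e]
    refine N.dominated _ _ q hqinj.injOn fun j => ?_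
    rw [Finsupp.smul_apply, smul_eq_mul, abs_mul, abs_of_nonneg hε0]
    by_cases hj : j < n
    · rw [restr_apply_mem (Finset.mem_range.mpr hj),
        restr_apply_mem (Finset.mem_image_of_mem q (Finset.mem_range.mpr hj)),
        sum_restr_apply hM a (fun j => x (k j)) (fun j => Finset.Subset.refl _) hj (hqI j),
        restr_apply_mem (hqI j), abs_mul, mul_comm]
      exact mul_le_mul_of_nonneg_left (hq j) (abs_nonneg _)
    · rw [restr_apply, if_neg (by simpa using hj), abs_zero, mul_zero]
      exact abs_nonneg _
  have h2 : N (restr S ((Finset.range n).image q)) ≤ ‖ofFinsupp N S‖ := by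
    refine restr_le (ofFinsupp N S) fun i hi => ?_
    obtain ⟨j, -, rfl⟩ := Finset.mem_image.mp hi
    have h3 : M 0 ≤ M j := hM.monotone (Nat.zero_le j)
    have h4 := (Finset.mem_Ico.mp (hqI j)).1
    have h5 : ((Finset.range n).image q).card ≤ n := Finset.card_image_le.trans (by simp)
    omega
  have h3 := h.norm_sum_sub_le ha n
  rw [norm_sub_rev] at h3
  have h4 := norm_le_norm_add_norm_sub' (ofFinsupp N S) (∑ j ∈ Finset.range n, a j • x (k j))
  linarith

include h hM ha in
theorem mul_sqrt_le {ε : ℝ} (hε : δ ≤ ε) (hxε : ∀ j, ε ≤ ‖x (k j)‖) (n : ℕ) :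
    (ε - δ) * √(∑ j ∈ Finset.range n, a j ^ 2) ≤
      ‖∑ j ∈ Finset.range n, a j • x (k j)‖ + n * δ := by
  have key : ∀ n, (ε - δ) ^ 2 * ∑ j ∈ Finset.range n, a j ^ 2 ≤
      ‖ofFinsupp N (∑ j ∈ Finset.range n,
        a j • restr (x (k j)) (Finset.Ico (M j) (M (j + 1))))‖ ^ 2 := by
    intro n
    induction n with
    | zero => simp
    | succ n ih =>
      rw [Finset.sum_range_succ, Finset.sum_range_succ, map_add]
      refine le_trans ?_ (norm_sq_add_le fun p => ?_)
      · rw [mul_add]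
        refine add_le_add ih ?_
        rw [map_smul, norm_smul, mul_pow, Real.norm_eq_abs, sq_abs, mul_comm]
        refine mul_le_mul_of_nonneg_left ?_ (sq_nonneg _)
        refine pow_le_pow_left₀ (by linarith) ?_ 2
        have h1 := norm_le_norm_add_norm_sub' (x (k n))
          (ofFinsupp N (restr (x (k n)) (Finset.Ico (M n) (M (n + 1)))))
        linarith [h.approx n, hxε n]
      · by_contra hne
        push Not at hne
        obtain ⟨j, hj, hpj⟩ := exists_of_sum_restr_ne_zero hne.1
        have h2 : p ∈ Finset.Ico (M n) (M (n + 1)) := by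
          by_contra hp
          refine hne.2 ?_
          rw [ofFinsupp_apply, Finsupp.smul_apply, restr_apply, if_neg hp, smul_zero]
        have := mem_Ico_unique hM hpj h2
        omega
  have h1 : (ε - δ) * √(∑ j ∈ Finset.range n, a j ^ 2) ≤ ‖ofFinsupp N (∑ j ∈ Finset.range n,
        a j • restr (x (k j)) (Finset.Ico (M j) (M (j + 1))))‖ := by
    refine abs_le_of_sq_le_sq' ?_ (norm_nonneg _) |>.2
    rw [mul_pow, Real.sq_sqrt (by positivity)]
    exact key n
  have h3 := h.norm_sum_sub_le ha n
  rw [norm_sub_rev] at h3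
  have h4 := norm_le_norm_add_norm_sub' (ofFinsupp N (∑ j ∈ Finset.range n,
        a j • restr (x (k j)) (Finset.Ico (M j) (M (j + 1)))))
    (∑ j ∈ Finset.range n, a j • x (k j))
  linarith

end IsBlocked

end Space

end TensorNorm

namespace TensorNorm

theorem l2_restr (a : ℕ → ℝ) (E : Finset ℕ) : l2 (restr a E) = √(∑ j ∈ E, a j ^ 2) := by
  rw [← l2_restr_sq, Real.sqrt_sq (l2.nonneg _)]

namespace Space

/-- Asymptotic estimates for linear combinations of bounded coordinatewise null sequences: a member
of the family behaves like `ℓ₂` if its coordinates tend to `0` uniformly, and otherwise it behaves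
like the unit vectors. -/
theorem exists_asymptotic_estimates {ι : Type*} [Finite ι] {N : ι → TensorNorm}
    (x : ∀ i, ℕ → (N i).Space) (hx : ∀ i k, ‖x i k‖ ≤ 1)
    (h0 : ∀ i p, Tendsto (fun k => x i k p) atTop (𝓝 0)) :
    ∃ (T : Set ι) (c : ι → ℝ), (∀ i, 0 < c i) ∧ ∀ (n : ℕ) (a : ℕ → ℝ), (∀ j, |a j| ≤ 1) →
      ∃ k : ℕ → ℕ, StrictMono k ∧ (∀ j, n ≤ k j) ∧ ∀ i,
        ‖∑ j ∈ Finset.range n, a j • x i (k j)‖ ≤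
          2 * l2 (restr a (Finset.range n)) + 2 * N i (restr a (Finset.range n)) ∧
        (i ∉ T → ‖∑ j ∈ Finset.range n, a j • x i (k j)‖ ≤ 2 * l2 (restr a (Finset.range n))) ∧
        (i ∈ T → c i * N i (restr a (Finset.range n)) ≤
          ‖∑ j ∈ Finset.range n, a j • x i (k j)‖) ∧
        ((∀ᶠ k in (hyperfilter ℕ : Filter ℕ), ‖x i k‖ = 1) →
          l2 (restr a (Finset.range n)) ≤ 4 * ‖∑ j ∈ Finset.range n, a j • x i (k j)‖) := by
  classical
  set U := hyperfilter ℕ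
  have hU : (U : Filter ℕ) ≤ atTop := Nat.hyperfilter_le_atTop
  have h0U : ∀ i p, Tendsto (fun k => x i k p) U (𝓝 0) := fun i p => (h0 i p).mono_left hU
  choose b hb1 hb2 hb3 using fun i => exists_profile U (x i) (hx i) (h0U i)
  set T : Set ι := {i | ¬ ∀ ε > 0, ∀ᶠ k in U, ∀ p, |x i k p| ≤ ε} with hT
  have hε : ∀ i, ∃ ε > 0, i ∈ T → ∀ᶠ k in U, ∃ p, ε ≤ |x i k p| := by
    intro i
    by_cases hi : i ∈ T
    · have hi' := hi
      rw [hT, Set.mem_ofPred_eq] at hi'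
      push Not at hi'
      obtain ⟨ε, hε, h⟩ := hi'
      refine ⟨ε, hε, fun _ => ?_⟩
      filter_upwards [h] with k hk
      obtain ⟨p, hp⟩ := hk
      exact ⟨p, hp.le⟩
    · exact ⟨1, one_pos, fun h => absurd h hi⟩
  choose ε hε hεT using hε
  refine ⟨T, fun i => ε i / 2, fun i => half_pos (hε i), fun n a ha => ?_⟩
  set A := restr a (Finset.range n) with hA
  rcases (l2.nonneg A).eq_or_lt with hs | hs
  · have hA0 : A = 0 := l2.eq_zero_of_eq_zero hs.symm
    have ha0 : ∀ j ∈ Finset.range n, a j = 0 := fun j hj => by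
      rw [← restr_apply_mem (x := a) hj, ← hA, hA0]
      rfl
    refine ⟨fun j => n + j, fun i j hij => Nat.add_lt_add_left hij n,
      fun j => Nat.le_add_right n j, fun i => ?_⟩
    have hsum : ∑ j ∈ Finset.range n, a j • x i (n + j) = 0 :=
      Finset.sum_eq_zero fun j hj => by rw [ha0 j hj, zero_smul]
    rw [hsum, hA0, l2.zero_eq, (N i).zero_eq]
    simp
  set s := l2 A with hsdef
  have hn1 : (0 : ℝ) < n + 1 := by positivity
  obtain ⟨δ, hδ, hδ1, hδ2, hδ3⟩ : ∃ δ > 0, δ < 1 / 2 ∧ n * δ ≤ s / 4 ∧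
      ∀ i, δ < ε i ∧ n * δ ≤ ε i * s / 2 := by
    have hev : ∀ r : ℝ, 0 < r → ∀ᶠ δ in 𝓝[>] (0 : ℝ), δ < r := fun r hr =>
      (eventually_lt_nhds hr).filter_mono nhdsWithin_le_nhds
    have hmul : ∀ δ r : ℝ, 0 < δ → δ < r / (n + 1) → n * δ ≤ r := fun δ r hδ h => by
      rw [lt_div_iff₀ hn1] at h
      linarith
    obtain ⟨δ, hδ, h1, h2, h3, h4⟩ := ((eventually_mem_nhdsWithin (a := (0 : ℝ))).and
      ((hev (1 / 2) (by norm_num)).and ((hev (s / 4 / (n + 1)) (by positivity)).and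
        ((eventually_all.mpr fun i => hev (ε i) (hε i)).and (eventually_all.mpr fun i =>
          hev (ε i * s / 2 / (n + 1)) (by have := hε i; positivity)))))).exists
    exact ⟨δ, hδ, h1, hmul δ _ hδ h2, fun i => ⟨h3 i, hmul δ _ hδ (h4 i)⟩⟩
  obtain ⟨κ, hκ⟩ := (Set.finite_range fun i => (N i).unit).bddAbove
  have hκ' : ∀ i, (N i).unit ≤ max κ 1 := fun i => (hκ ⟨i, rfl⟩).trans (le_max_left _ _)
  set κ' := max κ 1
  have hκ0 : 0 < κ' := one_pos.trans_le (le_max_right κ 1)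
  have hη : ∀ M : ℕ, 0 < δ / (κ' * ((M : ℝ) ^ 2 + 1)) := fun M => by positivity
  have hη' : ∀ i, ∀ M : ℕ, M * ((N i).unit * (M * (δ / (κ' * ((M : ℝ) ^ 2 + 1))))) ≤ δ := by
    intro i M
    have e : M * ((N i).unit * (M * (δ / (κ' * ((M : ℝ) ^ 2 + 1))))) =
        ((N i).unit * (M : ℝ) ^ 2 * δ) / (κ' * ((M : ℝ) ^ 2 + 1)) := by ring
    rw [e, div_le_iff₀ (by positivity)]
    have h1 := mul_le_mul_of_nonneg_right (hκ' i) (by positivity : 0 ≤ (M : ℝ) ^ 2 * δ)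
    nlinarith [mul_pos hκ0 hδ]
  have hQ : ∀ᶠ k in U, ∀ i, (i ∈ T → ∃ p, ε i ≤ |x i k p|) ∧
      ((∀ᶠ k in U, ‖x i k‖ = 1) → ‖x i k‖ = 1) := by
    refine eventually_all.mpr fun i => Filter.Eventually.and ?_ ?_
    · by_cases hi : i ∈ T
      · filter_upwards [hεT i hi] with k hk _ using hk
      · exact Eventually.of_forall fun k h => absurd h hi
    · by_cases hi : ∀ᶠ k in U, ‖x i k‖ = 1
      · filter_upwards [hi] with k hk _ using hk
      · exact Eventually.of_forall fun k h => absurd h hi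
  obtain ⟨k, M, hk, hM, hkn, hMn, hkQ, hblock⟩ := exists_isBlocked U hU x h0U b hb3 hQ n hδ hη
  refine ⟨k, hk, hkn, fun i => ⟨?_, fun hi => ?_, fun hi => ?_, fun hi => ?_⟩⟩
  · have := (hblock i).norm_sum_le hM ha (hx i) hδ.le hη (hη' i) (hb1 i) n
    rw [← l2_restr, ← hA, ← hsdef] at this
    linarith
  · have hb0 : b i = 0 := hb2 i (not_not.mp hi)
    have := (hblock i).norm_sum_le hM ha (hx i) hδ.le hη (hη' i) (β := 0) (fun F => by
      rw [hb0, restr_zero, (N i).zero_eq]) n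
    rw [← l2_restr, ← hA, ← hsdef] at this
    linarith
  · have h1 := (hblock i).mul_norm_le hM ha (hδ3 i).1 (fun j => (hkQ j i).1 hi) (hMn 0)
    rw [← hA] at h1
    have h2 := mul_le_mul_of_nonneg_left ((N i).l2_le A) (hε i).le
    have h3 := (hδ3 i).2
    linarith
  · have h1 := (hblock i).mul_sqrt_le hM ha (ε := 1) (by linarith)
      (fun j => ((hkQ j i).2 hi).ge) n
    rw [← l2_restr, ← hA, ← hsdef] at h1
    have h2 : 1 / 2 * s ≤ (1 - δ) * s := mul_le_mul_of_nonneg_right (by linarith) hs.le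
    linarith

variable {N : TensorNorm}

/-- A functional cannot be bounded below on a bounded coordinatewise null sequence. -/
theorem not_forall_le_apply (f : StrongDual ℝ N.Space) {x : ℕ → N.Space} (hx : ∀ k, ‖x k‖ ≤ 1)
    (h0 : ∀ p, Tendsto (fun k => x k p) atTop (𝓝 0)) {ε : ℝ} (hε : 0 < ε) :
    ¬ ∀ k, ε ≤ f (x k) := by
  intro hf
  obtain ⟨T, c, -, h⟩ := exists_asymptotic_estimates (ι := Unit) (fun _ => x) (fun _ => hx)
    fun _ => h0
  have hlim : Tendsto (fun n : ℕ => ‖f‖ * (2 * (l2 (restr 1 (Finset.range n)) / n) +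
      2 * (N (restr 1 (Finset.range n)) / n))) atTop (𝓝 0) := by
    simpa using ((l2.average.const_mul 2).add (N.average.const_mul 2)).const_mul ‖f‖
  obtain ⟨n, hn1, hn⟩ := ((hlim.eventually_lt_const hε).and (eventually_gt_atTop 0)).exists
  obtain ⟨k, -, -, hk⟩ := h n 1 (by simp)
  have h1 := (hk ()).1
  have hn' : (0 : ℝ) < n := by exact_mod_cast hn
  have h2 : n * ε ≤ f (∑ j ∈ Finset.range n, (1 : ℕ → ℝ) j • x (k j)) := by
    rw [map_sum]
    refine le_trans (by simp) (Finset.sum_le_sum (f := fun _ => ε) fun j _ => ?_)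
    simpa using hf (k j)
  have h3 := (le_abs_self _).trans (f.le_opNorm (∑ j ∈ Finset.range n, (1 : ℕ → ℝ) j • x (k j)))
  have h4 := mul_le_mul_of_nonneg_left h1 (norm_nonneg f)
  have h5 : ‖f‖ * (2 * (l2 (restr 1 (Finset.range n)) / n) +
      2 * (N (restr 1 (Finset.range n)) / n)) * n = ‖f‖ * (2 * l2 (restr 1 (Finset.range n)) +
      2 * N (restr 1 (Finset.range n))) := by
    field_simp
  have h6 := mul_lt_mul_of_pos_right hn1 hn'
  rw [h5] at h6
  linarith

/-- Functionals are small on the tails of the space. -/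
theorem exists_forall_abs_apply_le (f : StrongDual ℝ N.Space) {ε : ℝ} (hε : 0 < ε) :
    ∃ n, ∀ x : N.Space, ‖x‖ ≤ 1 → (∀ p < n, x p = 0) → |f x| ≤ ε := by
  by_contra! h
  choose x hx1 hx2 hx3 using h
  have hs : ∀ t : ℝ, |(SignType.sign t : ℝ)| ≤ 1 := fun t => by
    rcases lt_trichotomy t 0 with h | h | h <;> simp [h]
  refine not_forall_le_apply f (x := fun k => (SignType.sign (f (x k)) : ℝ) • x k) (fun k => ?_)
    (fun p => ?_) hε fun k => ?_
  · rw [norm_smul]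
    exact mul_le_one₀ (hs _) (norm_nonneg _) (hx1 k)
  · refine tendsto_const_nhds.congr' ?_
    filter_upwards [eventually_gt_atTop p] with k hk
    rw [smul_apply, hx2 k p hk, mul_zero]
  · rw [map_smul, smul_eq_mul, sign_mul_self]
    exact (hx3 k).le

/-- The functional `x ↦ f (x₀, …, x_{n-1}, 0, …)`. -/
noncomputable def truncate (f : StrongDual ℝ N.Space) (n : ℕ) : StrongDual ℝ N.Space :=
  ∑ p ∈ Finset.range n, f (e N p) • coord N p

theorem truncate_apply (f : StrongDual ℝ N.Space) (n : ℕ) (x : N.Space) :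
    truncate f n x = f (ofFinsupp N (restr x (Finset.range n))) := by
  rw [ofFinsupp_restr, map_sum, truncate]
  simp [mul_comm]

theorem norm_sub_restr_le (x : N.Space) (n : ℕ) :
    ‖x - ofFinsupp N (restr x (Finset.range n))‖ ≤ ‖x‖ :=
  norm_mono fun p => by
    rw [sub_apply, ofFinsupp_apply, restr_apply]
    split_ifs <;> simp

theorem norm_restr_le (x : N.Space) (n : ℕ) : ‖ofFinsupp N (restr x (Finset.range n))‖ ≤ ‖x‖ :=
  norm_mono fun p => by
    rw [ofFinsupp_apply, restr_apply]
    split_ifs <;> simp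

theorem tendsto_truncate (f : StrongDual ℝ N.Space) :
    Tendsto (fun n => truncate f n) atTop (𝓝 f) := by
  rw [tendsto_iff_norm_sub_tendsto_zero, Metric.tendsto_atTop]
  intro ε hε
  obtain ⟨n₀, hn₀⟩ := exists_forall_abs_apply_le f (half_pos hε)
  refine ⟨n₀, fun n hn => ?_⟩
  rw [Real.dist_eq, sub_zero, abs_of_nonneg (norm_nonneg _)]
  refine lt_of_le_of_lt (ContinuousLinearMap.opNorm_le_of_unit_norm (half_pos hε).le
    fun x hx => ?_) (half_lt_self hε)
  have h1 : (truncate f n - f) x = -f (x - ofFinsupp N (restr x (Finset.range n))) := by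
    rw [_root_.sub_apply, truncate_apply, map_sub]
    ring
  rw [h1, norm_neg]
  refine hn₀ _ ((norm_sub_restr_le x n).trans hx.le) fun p hp => ?_
  rw [sub_apply, ofFinsupp_apply, restr_apply_mem (Finset.mem_range.mpr (hp.trans_le hn)), sub_self]

theorem norm_truncate_le (f : StrongDual ℝ N.Space) (n : ℕ) : ‖truncate f n‖ ≤ ‖f‖ := by
  refine ContinuousLinearMap.opNorm_le_bound _ (norm_nonneg f) fun x => ?_
  rw [truncate_apply]
  exact (f.le_opNorm _).trans (mul_le_mul_of_nonneg_left (norm_restr_le x n) (norm_nonneg f))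

variable (N) in
theorem isReflexiveSpace : IsReflexiveSpace N.Space := by
  intro F
  let c : ℕ → ℝ := fun p => F (coord N p)
  have hF : ∀ f n, f (ofFinsupp N (restr c (Finset.range n))) = F (truncate f n) := by
    intro f n
    rw [ofFinsupp_restr, map_sum, truncate, map_sum]
    simp [c, mul_comm]
  have hbound : ∀ n, ‖ofFinsupp N (restr c (Finset.range n))‖ ≤ ‖F‖ := fun n =>
    NormedSpace.norm_le_dual_bound ℝ _ (norm_nonneg F) fun f => by
      rw [hF]
      exact (F.le_opNorm _).trans
        (mul_le_mul_of_nonneg_left (norm_truncate_le f n) (norm_nonneg F))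
  let x : N.Space := ⟨c, ‖F‖, fun 𝓔 h𝓔 => by
    obtain ⟨M, hM⟩ : ∃ M, 𝓔.biUnion id ⊆ Finset.range M :=
      ⟨(𝓔.biUnion id).sup id + 1, fun p hp => Finset.mem_range.mpr
        (Nat.lt_succ_of_le (Finset.le_sup (f := id) hp))⟩
    refine le_trans (le_of_eq ?_) ((familyNorm_le _ h𝓔).trans (hbound M))
    refine congrArg Real.sqrt (Finset.sum_congr rfl fun E hE => ?_)
    rw [restr_congr (y := ofFinsupp N (restr c (Finset.range M))) fun p hp => ?_]
    rw [ofFinsupp_apply, restr_apply_mem (hM (Finset.mem_biUnion.mpr ⟨E, hE, hp⟩))]⟩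
  refine ⟨x, ContinuousLinearMap.ext fun f => ?_⟩
  rw [NormedSpace.dual_def]
  refine tendsto_nhds_unique ((f.continuous.tendsto x).comp x.tendsto_restr) ?_
  refine ((F.continuous.tendsto f).comp (tendsto_truncate f)).congr fun n => ?_
  exact (hF f n).symm

/-- Bounded coordinatewise null sequences are weakly null. -/
theorem isWeaklyNull {x : ℕ → N.Space} {C : ℝ} (hx : ∀ k, ‖x k‖ ≤ C)
    (h0 : ∀ p, Tendsto (fun k => x k p) atTop (𝓝 0)) : IsWeaklyNull x := by
  intro f
  have hC : 0 ≤ C := (norm_nonneg _).trans (hx 0)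
  rw [Metric.tendsto_atTop]
  intro ε hε
  have h1 : Tendsto (fun n => ‖truncate f n - f‖ * C) atTop (𝓝 0) := by
    simpa using (tendsto_iff_norm_sub_tendsto_zero.mp (tendsto_truncate f)).mul_const C
  obtain ⟨n, hn⟩ := (h1.eventually_lt_const (half_pos hε)).exists
  have h2 : Tendsto (fun k => |truncate f n (x k)|) atTop (𝓝 0) := by
    have := (tendsto_finsetSum (Finset.range n) fun p _ => (h0 p).const_mul (f (e N p))).abs
    simpa [truncate] using this
  obtain ⟨k₀, hk₀⟩ := eventually_atTop.mp (h2.eventually_lt_const (half_pos hε))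
  refine ⟨k₀, fun k hk => ?_⟩
  have h3 := ((truncate f n - f).le_opNorm (x k)).trans
    (mul_le_mul_of_nonneg_left (hx k) (norm_nonneg _))
  rw [_root_.sub_apply, Real.norm_eq_abs] at h3
  rw [Real.dist_eq, sub_zero]
  have h4 := abs_sub_abs_le_abs_sub (f (x k)) (truncate f n (x k))
  rw [abs_sub_comm] at h4
  linarith [hk₀ k hk]

end Space

end TensorNorm

theorem isReflexiveSpace_pi {ι : Type*} [Fintype ι] {E : ι → Type*}
    [∀ i, NormedAddCommGroup (E i)] [∀ i, NormedSpace ℝ (E i)] (h : ∀ i, IsReflexiveSpace (E i)) :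
    IsReflexiveSpace (∀ i, E i) := by
  classical
  intro F
  let P : ∀ i, StrongDual ℝ (E i) →L[ℝ] StrongDual ℝ (∀ i, E i) := fun i =>
    (ContinuousLinearMap.compL ℝ (∀ i, E i) (E i) ℝ).flip (ContinuousLinearMap.proj i)
  choose v hv using fun i => h i (F.comp (P i))
  refine ⟨v, ContinuousLinearMap.ext fun f => ?_⟩
  rw [NormedSpace.dual_def]
  have hf : f = ∑ i, P i (f.comp (ContinuousLinearMap.single ℝ E i)) := by
    ext w
    have : w = ∑ i, Pi.single i (w i) := (Finset.univ_sum_single w).symm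
    conv_lhs => rw [this, map_sum]
    simp [P]
  conv_rhs => rw [hf, map_sum]
  have : v = ∑ i, Pi.single i (v i) := (Finset.univ_sum_single v).symm
  conv_lhs => rw [this, map_sum]
  refine Finset.sum_congr rfl fun i _ => ?_
  have := congrArg (fun G => G (f.comp (ContinuousLinearMap.single ℝ E i))) (hv i)
  simpa [NormedSpace.dual_def] using this

theorem isBasicSequence_of_coord {X : Type*} [NormedAddCommGroup X] [NormedSpace ℝ X] {x : ℕ → X}
    (f : ℕ → StrongDual ℝ X) (hf : ∀ i j, f i (x j) = if i = j then 1 else 0)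
    {V : Submodule ℝ X} (hV : IsClosed (V : Set X)) (hxV : ∀ i, x i ∈ V)
    (h : ∀ v ∈ V, Tendsto (fun n => ∑ i ∈ Finset.range n, f i v • x i) atTop (𝓝 v)) :
    IsBasicSequence x := by
  have hle : (Submodule.span ℝ (Set.range x)).topologicalClosure ≤ V :=
    Submodule.topologicalClosure_minimal _ (Submodule.span_le.mpr (by
      rintro _ ⟨i, rfl⟩
      exact hxV i)) hV
  refine ⟨{
    basis := fun i => ⟨x i, Submodule.le_topologicalClosure _ (Submodule.subset_span ⟨i, rfl⟩)⟩
    coord := fun i => (f i).comp (Submodule.subtypeL _)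
    ortho := fun i j => by
      simp [hf, Pi.single_apply]
    expansion := fun v => ?_ }, fun i => rfl⟩
  rw [HasSum, SummationFilter.conditional_filter_eq_map_range, tendsto_map'_iff,
    tendsto_subtype_rng]
  refine (h v (hle v.2)).congr fun n => ?_
  simp

namespace TensorNorm

/-- The norm `N`, normalized such that the unit vectors have norm `1`. -/
noncomputable def normalized (N : TensorNorm) : Seminorm ℝ (ℕ →₀ ℝ) :=
  Seminorm.of (fun c => N.unit⁻¹ * N c)
    (fun a b => by
      rw [← mul_add]
      exact mul_le_mul_of_nonneg_left (N.add_le a b) (inv_nonneg.mpr N.unit_pos.le))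
    (fun t a => by
      rw [N.smul_eq, Real.norm_eq_abs]
      ring)

theorem normalized_apply (N : TensorNorm) (c : ℕ →₀ ℝ) : N.normalized c = N.unit⁻¹ * N c := rfl

variable {ι : Type*} [Fintype ι] [DecidableEq ι] (N : ι → TensorNorm)

/-- The normalized unit vectors of the `z`-th summand of the product of the spaces. -/
noncomputable def unitVec (z : ι) (k : ℕ) : ∀ i, (N i).Space :=
  Pi.single z ((N z).unit⁻¹ • Space.e (N z) k)

theorem norm_pi_single (z : ι) (v : (N z).Space) :
    ‖(Pi.single z v : ∀ i, (N i).Space)‖ = ‖v‖ :=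
  Pi.norm_single (G := fun i => (N i).Space) v

theorem norm_sum_unitVec (z : ι) {n : ℕ} (a : Fin n → ℝ) {k : Fin n → ℕ} (hk : StrictMono k)
    (hkn : ∀ i, n ≤ k i + 1) : ‖∑ i, a i • unitVec N z (k i)‖ =
      (N z).normalized (∑ i : Fin n, Finsupp.single (i : ℕ) (a i)) := by
  classical
  set c : ℕ →₀ ℝ := ∑ i : Fin n, Finsupp.single (k i) (a i)
  set d : ℕ →₀ ℝ := ∑ i : Fin n, Finsupp.single (i : ℕ) (a i)
  have hc : ∀ i, c (k i) = a i := fun i => by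
    simp [c, Finsupp.finsetSum_apply, Finsupp.single_apply, hk.injective.eq_iff]
  have hd : ∀ i : Fin n, d i = a i := fun i => by
    simp [d, Finsupp.finsetSum_apply, Finsupp.single_apply, Fin.val_inj]
  have hcs : c.support ⊆ Finset.univ.image k := by
    refine Finsupp.support_finsetSum.trans fun p hp => ?_
    obtain ⟨i, hi, hp⟩ := Finset.mem_biUnion.mp hp
    have := Finsupp.support_single_subset hp
    rw [Finset.mem_singleton] at this
    exact Finset.mem_image.mpr ⟨i, hi, this.symm⟩
  have hds : ∀ p, d p ≠ 0 → p < n := by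
    intro p hp
    by_contra hlt
    refine hp ?_
    simp only [d, Finsupp.finsetSum_apply]
    refine Finset.sum_eq_zero fun i _ => Finsupp.single_eq_of_ne ?_
    have := i.2
    omega
  have h1 : ∑ i, a i • unitVec N z (k i) =
      Pi.single z ((N z).unit⁻¹ • Space.ofFinsupp (N z) c) := by
    rw [map_sum, Finset.smul_sum]
    have h2 : ∀ i, a i • unitVec N z (k i) = ContinuousLinearMap.single ℝ (fun i => (N i).Space) z
        ((N z).unit⁻¹ • Space.ofFinsupp (N z) (Finsupp.single (k i) (a i))) := by
      intro i
      have : (Finsupp.single (k i) (a i) : ℕ →₀ ℝ) = a i • Finsupp.single (k i) 1 := by simp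
      rw [this, map_smul (Space.ofFinsupp (N z)), smul_comm, map_smul]
      rfl
    simp only [h2]
    rw [← map_sum]
    rfl
  rw [h1, norm_pi_single, norm_smul, Space.norm_ofFinsupp, normalized_apply, norm_inv,
    Real.norm_of_nonneg (N z).unit_pos.le]
  · congr 1
    refine le_antisymm ?_ ?_
    · have hinv : ∀ p ∈ c.support, ∃ i : ℕ, ∃ h : i < n, k ⟨i, h⟩ = p := fun p hp => by
        obtain ⟨i, -, hi⟩ := Finset.mem_image.mp (hcs hp)
        exact ⟨i, i.2, hi⟩
      choose! σ hσ1 hσ2 using hinv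
      refine (N z).dominated c d σ (fun p hp q hq hpq => ?_) fun p => ?_
      · rw [← hσ2 p hp, ← hσ2 q hq]
        congr 2
      · by_cases hp : p ∈ c.support
        · have h3 := hd ⟨σ p, hσ1 p hp⟩
          have h4 := hc ⟨σ p, hσ1 p hp⟩
          rw [hσ2 p hp] at h4
          rw [h4]
          exact (congrArg abs h3).ge
        · rw [Finsupp.notMem_support_iff.mp hp, abs_zero]
          exact abs_nonneg _
    · refine (N z).dominated d c (fun p => if h : p < n then k ⟨p, h⟩ else 0)
        (fun p hp q hq hpq => ?_) fun p => ?_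
      · have h3 := hds p (Finsupp.mem_support_iff.mp hp)
        have h4 := hds q (Finsupp.mem_support_iff.mp hq)
        simp only [h3, h4, dif_pos] at hpq
        simpa using hk.injective hpq
      · by_cases hp : p < n
        · simp only [hp, dif_pos]
          rw [hc, ← hd]
        · have : d p = 0 := by
            by_contra h
            exact hp (hds p h)
          rw [this, abs_zero]
          exact abs_nonneg _
  · intro p hp
    obtain ⟨i, -, rfl⟩ := Finset.mem_image.mp (hcs hp)
    refine (Finset.card_le_card hcs).trans (Finset.card_image_le.trans ?_)
    simpa using hkn i

theorem norm_unitVec (z : ι) (k : ℕ) : ‖unitVec N z k‖ = 1 := by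
  rw [unitVec, norm_pi_single, norm_smul, Space.norm_e, norm_inv,
    Real.norm_of_nonneg (N z).unit_pos.le, inv_mul_cancel₀ (N z).unit_pos.ne']

theorem isWeaklyNull_unitVec (z : ι) : IsWeaklyNull (unitVec N z) := by
  intro f
  refine Space.isWeaklyNull (N := N z) (x := fun k => (N z).unit⁻¹ • Space.e (N z) k) (C := 1)
    (fun k => ?_) (fun p => ?_) (f.comp (ContinuousLinearMap.single ℝ (fun i => (N i).Space) z))
  · rw [← norm_pi_single N z]
    exact (norm_unitVec N z k).le
  · refine tendsto_const_nhds.congr' ?_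
    filter_upwards [eventually_gt_atTop p] with k hk
    rw [Space.smul_apply, Space.e_apply, if_neg hk.ne', mul_zero]

theorem isBasicSequence_unitVec (z : ι) : IsBasicSequence (unitVec N z) := by
  have hu := (N z).unit_pos.ne'
  let S := ContinuousLinearMap.single ℝ (fun i => (N i).Space) z
  let P : (∀ i, (N i).Space) →L[ℝ] (N z).Space := ContinuousLinearMap.proj z
  refine isBasicSequence_of_coord
    (fun i => (N z).unit • (Space.coord (N z) i).comp P)
    (fun i j => ?_) (V := (ContinuousLinearMap.id ℝ _ - S.comp P).ker)
    (ContinuousLinearMap.isClosed_ker _) (fun i => ?_) fun v hv => ?_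
  · simp [P, unitVec, Space.e_apply, hu, eq_comm]
  · simp [P, S, unitVec]
  · have hv' : S (v z) = v := by
      have : v - S (P v) = 0 := hv
      exact (sub_eq_zero.mp this).symm
    have h1 := (S.continuous.tendsto (v z)).comp (v z).tendsto_restr
    rw [hv'] at h1
    refine h1.congr fun n => ?_
    rw [Function.comp_apply, Space.ofFinsupp_restr, map_sum]
    refine Finset.sum_congr rfl fun i _ => ?_
    change S (v z i • Space.e (N z) i) = ((N z).unit * v z i) • S ((N z).unit⁻¹ • Space.e (N z) i)
    rw [← map_smul, smul_smul, mul_right_comm, mul_inv_cancel₀ hu, one_mul]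

theorem generatesSpreadingModel_unitVec (z : ι) :
    GeneratesSpreadingModel (unitVec N z) (N z).normalized := by
  refine ⟨norm_unitVec N z, isBasicSequence_unitVec N z, fun a ha => ?_, 0, antitone_const,
    tendsto_const_nhds, fun n a _ k hk hkn => ?_⟩
  · rw [normalized_apply] at ha
    exact (N z).eq_zero_of_eq_zero
      ((mul_eq_zero.mp ha).resolve_left (inv_ne_zero (N z).unit_pos.ne'))
  · rw [norm_sum_unitVec N z a hk hkn]
    simp

/-- The spreading model generated by the unit vectors of the `z`-th summand. -/
noncomputable def unitModel (z : ι) : WeakSpreadingModel (∀ i, (N i).Space) :=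
  ⟨(N z).normalized, unitVec N z, isWeaklyNull_unitVec N z, generatesSpreadingModel_unitVec N z⟩

end TensorNorm

open TensorNorm LorentzWeight

/-- Indices of the Lorentz norms that enter the norm associated with the `i`-th element of `L`. -/
noncomputable def notAbove {ι L : Type*} [Fintype ι] [LE L] (e : ι → L) (i : ι) : Finset ι :=
  open Classical in Finset.univ.filter fun s => ¬ e i ≤ e s

theorem mem_notAbove {ι L : Type*} [Fintype ι] [LE L] {e : ι → L} {i s : ι} :
    s ∈ notAbove e i ↔ ¬ e i ≤ e s := by
  classical
  simp [notAbove]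

/-- The norm associated with the `i`-th element of `L`. -/
noncomputable def latticeNorm {m : ℕ} {L : Type*} [LE L] (e : Fin m → L) (i : Fin m) : TensorNorm :=
  (exists_hilbertSum (notAbove e i) fun s => (lacunary s).toTensorNorm).choose

section

variable {m : ℕ} {L : Type*} (e : Fin m → L)

theorem latticeNorm_sq [LE L] (i : Fin m) (c : ℕ →₀ ℝ) : latticeNorm e i c ^ 2 =
    l2 c ^ 2 + ∑ s ∈ notAbove e i, (lacunary s).toTensorNorm c ^ 2 :=
  (exists_hilbertSum (notAbove e i) fun s => (lacunary s).toTensorNorm).choose_spec c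

theorem lorentz_le_latticeNorm [LE L] {i s : Fin m} (h : ¬ e i ≤ e s) (c : ℕ →₀ ℝ) :
    (lacunary s).toTensorNorm c ≤ latticeNorm e i c := by
  refine abs_le_of_sq_le_sq' ?_ (TensorNorm.nonneg _ _) |>.2
  rw [latticeNorm_sq]
  have := Finset.single_le_sum (f := fun s : Fin m => (lacunary s).toTensorNorm c ^ 2)
    (fun _ _ => sq_nonneg _) (mem_notAbove.mpr h)
  exact this.trans (le_add_of_nonneg_left (sq_nonneg _))

theorem latticeNorm_le [LE L] {i : Fin m} {c : ℕ →₀ ℝ} {R : ℝ} (hl : l2 c ≤ R)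
    (h : ∀ s, ¬ e i ≤ e s → (lacunary s).toTensorNorm c ≤ R) :
    latticeNorm e i c ≤ (m + 1) * R := by
  have hR : 0 ≤ R := (l2.nonneg c).trans hl
  refine abs_le_of_sq_le_sq' ?_ (by positivity) |>.2
  rw [latticeNorm_sq]
  have h1 := pow_le_pow_left₀ (l2.nonneg c) hl 2
  have h2 : ∑ s ∈ notAbove e i, (lacunary s).toTensorNorm c ^ 2 ≤ m * R ^ 2 := by
    refine (Finset.sum_le_card_nsmul _ _ (R ^ 2) fun s hs => pow_le_pow_left₀
      (TensorNorm.nonneg _ _) (h s (mem_notAbove.mp hs)) 2).trans ?_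
    rw [nsmul_eq_mul]
    refine mul_le_mul_of_nonneg_right ?_ (sq_nonneg R)
    exact_mod_cast (Finset.card_le_univ _).trans (by simp)
  have hm : (0 : ℝ) ≤ m := Nat.cast_nonneg m
  nlinarith [mul_nonneg hm (sq_nonneg R), mul_nonneg (mul_nonneg hm hm) (sq_nonneg R)]

theorem latticeNorm_mono [Preorder L] {i j : Fin m} (h : e i ≤ e j) (c : ℕ →₀ ℝ) :
    latticeNorm e i c ≤ latticeNorm e j c := by
  refine abs_le_of_sq_le_sq' ?_ (TensorNorm.nonneg _ _) |>.2
  rw [latticeNorm_sq, latticeNorm_sq]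
  refine add_le_add le_rfl (Finset.sum_le_sum_of_subset_of_nonneg (fun s hs => ?_)
    fun _ _ _ => sq_nonneg _)
  rw [mem_notAbove] at hs ⊢
  exact fun hjs => hs (h.trans hjs)

/-- If `e z` is the least upper bound of the `e i` with `i ∈ T`, then the norm of `z` is dominated
by the norms of `ℓ₂` and of the elements of `T`. -/
theorem latticeNorm_le_of_isLUB [Preorder L] {z : Fin m} {T : Set (Fin m)}
    (hz : IsLUB (e '' T) (e z)) {c : ℕ →₀ ℝ} {R : ℝ} (hl : l2 c ≤ R)
    (h : ∀ i ∈ T, latticeNorm e i c ≤ R) : latticeNorm e z c ≤ (m + 1) * R := by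
  refine latticeNorm_le e hl fun s hs => ?_
  obtain ⟨i, hi, his⟩ : ∃ i ∈ T, ¬ e i ≤ e s := by
    by_contra! hne
    exact hs (hz.2 (by rintro _ ⟨i, hi, rfl⟩; exact hne i hi))
  exact (lorentz_le_latticeNorm e his c).trans (h i hi)

theorem not_latticeNorm_le_mul [Preorder L] {i j : Fin m} (hij : ¬ e i ≤ e j) (C : ℝ) :
    ¬ ∀ c, latticeNorm e i c ≤ C * latticeNorm e j c := by
  intro hC
  obtain ⟨r, hr⟩ := pow_unbounded_of_one_lt (|C| * (m + 1)) (one_lt_two (α := ℝ))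
  set k := Nat.pair j r
  set t : ℝ := 4 ^ (k + 1)
  have hk : k.unpair.1 = j := by simp [k]
  set c := restr 1 (Finset.range (2 ^ 16 ^ (k + 1)))
  have hval : ∀ s, (lacunary s).toTensorNorm c = lacunary s (2 ^ 16 ^ (k + 1)) := fun s => by
    rw [toTensorNorm_restr_one, Finset.card_range]
  have h1 : (2 : ℝ) ^ (t ^ 2 / 2 + 2 * t) ≤ latticeNorm e i c :=
    (le_lacunary hk).trans ((hval j).symm.trans_le (lorentz_le_latticeNorm e hij c))
  have h2 : latticeNorm e j c ≤ (m + 1) * (2 : ℝ) ^ (t ^ 2 / 2 + t) := by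
    refine latticeNorm_le e (((lacunary (j + 1)).toTensorNorm.l2_le c).trans ?_) fun s hs => ?_
    · rw [hval]
      exact lacunary_le (by omega)
    · rw [hval]
      refine lacunary_le ?_
      rw [hk]
      intro h
      exact hs (by rw [Fin.ext h])
  have h3 : (2 : ℝ) ^ (t ^ 2 / 2 + 2 * t) ≤ |C| * (m + 1) * (2 : ℝ) ^ (t ^ 2 / 2 + t) := by
    refine h1.trans ((hC c).trans ?_)
    rw [mul_assoc]
    exact (mul_le_mul_of_nonneg_right (le_abs_self C) (TensorNorm.nonneg _ _)).trans
      (mul_le_mul_of_nonneg_left h2 (abs_nonneg C))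
  have e1 : t ^ 2 / 2 + 2 * t = t + (t ^ 2 / 2 + t) := by ring
  rw [e1, Real.rpow_add (by norm_num)] at h3
  have h4 : (2 : ℝ) ^ t ≤ |C| * (m + 1) :=
    le_of_mul_le_mul_right h3 (Real.rpow_pos_of_pos (by norm_num) _)
  have h5 : (2 : ℝ) ^ r ≤ 2 ^ t := by
    rw [← Real.rpow_natCast]
    refine Real.rpow_le_rpow_of_exponent_le (by norm_num) ?_
    have h6 : r ≤ 4 ^ (k + 1) := by
      have h7 : r ≤ k := Nat.right_le_pair _ _
      have h8 : k + 1 < 4 ^ (k + 1) := Nat.lt_pow_self (by norm_num)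
      omega
    simp only [t]
    exact_mod_cast h6
  linarith

/-- The weak spreading models of the product space are equivalent to the spreading models generated
by the unit vectors. -/
theorem exists_equiv_unitModel [Lattice L] [Finite L] [Nonempty L] (he : Function.Surjective e)
    (M : WeakSpreadingModel (∀ i, (latticeNorm e i).Space)) :
    ∃ z, M ≤ unitModel (latticeNorm e) z ∧ unitModel (latticeNorm e) z ≤ M := by
  classical
  have := Fintype.ofFinite L
  let _ := Fintype.toOrderBot L
  obtain ⟨x, hxw, hx1, -, -, ε, hεa, hε0, hM⟩ := M.generated
  have hεn : ∀ n, 0 ≤ ε n := fun n => hεa.le_of_tendsto hε0 n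
  obtain ⟨T, c, hc, hest⟩ := Space.exists_asymptotic_estimates (fun i k => x k i)
    (fun i k => (norm_le_pi_norm (x k) i).trans (hx1 k).le)
    (fun i p => hxw ((Space.coord _ p).comp
      (ContinuousLinearMap.proj (φ := fun i => (latticeNorm e i).Space) i)))
  obtain ⟨z, hz⟩ := he (T.toFinset.sup e)
  have hlub : IsLUB (e '' T) (e z) := by
    rw [hz]
    constructor
    · rintro _ ⟨i, hi, rfl⟩
      exact Finset.le_sup (Set.mem_toFinset.mpr hi)
    · intro b hb
      exact Finset.sup_le fun i hi => hb ⟨i, Set.mem_toFinset.mp hi, rfl⟩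
  obtain ⟨i₀, -, hi₀⟩ : ∃ i ∈ (Set.univ : Set (Fin m)),
      ∀ᶠ k in (hyperfilter ℕ : Filter ℕ), ‖x k i‖ = 1 := by
    rw [← Ultrafilter.eventually_exists_mem_iff Set.finite_univ]
    refine Eventually.of_forall fun k => ?_
    by_contra! hne
    have : ‖x k‖ < 1 := (pi_norm_lt_iff one_pos).mpr fun i =>
      lt_of_le_of_ne ((norm_le_pi_norm (x k) i).trans (hx1 k).le) (hne i trivial)
    exact this.ne (hx1 k)
  set D := 1 + ε 0
  have hD : 0 < D := by linarith [hεn 0]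
  set B := 4 + ∑ i, (c i)⁻¹
  have hcB : ∀ i, (c i)⁻¹ ≤ B := fun i => by
    have := Finset.single_le_sum (f := fun i => (c i)⁻¹)
      (fun i _ => (inv_pos.mpr (hc i)).le) (Finset.mem_univ i)
    simp only [B]
    linarith
  have hB : 4 ≤ B := le_add_of_nonneg_right (Finset.sum_nonneg fun i _ => (inv_pos.mpr (hc i)).le)
  have key : ∀ a : ℕ →₀ ℝ, (∀ j, |a j| ≤ 1) →
      M.toSeminorm a ≤ D * 4 * latticeNorm e z a ∧
      latticeNorm e z a ≤ (m + 1) * (B * D) * M.toSeminorm a := by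
    intro a ha
    obtain ⟨n, hn⟩ : ∃ n, a.support ⊆ Finset.range n :=
      ⟨a.support.sup id + 1, fun p hp => Finset.mem_range.mpr
        (Nat.lt_succ_of_le (Finset.le_sup (f := id) hp))⟩
    have hra : restr a (Finset.range n) = a := restr_of_support_subset hn
    obtain ⟨k, hk, hkn, hk'⟩ := hest n a ha
    rw [hra] at hk'
    set S := ∑ j ∈ Finset.range n, a j • x (k j) with hS
    have hSi : ∀ i, ∑ j ∈ Finset.range n, a j • x (k j) i = S i := fun i => by
      rw [hS, Finset.sum_apply]
      rfl
    simp only [hSi] at hk'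
    have hgen := hM n (fun i => a i) (fun i => abs_le.mp (ha i)) (fun i => k i)
      (fun i j hij => hk hij) (fun i => (hkn i).trans (Nat.le_succ _))
    rw [Fin.sum_univ_eq_sum_range (fun j => a j • x (k j)) n,
      Fin.sum_univ_eq_sum_range (fun j => Finsupp.single j (a j)) n, ← restr_eq_sum, hra,
      ← hS] at hgen
    have hMa : 0 ≤ M.toSeminorm a := apply_nonneg _ _
    have hDn : 1 + ε n ≤ D := by linarith [hεa (Nat.zero_le n)]
    have hDn' : 0 < 1 + ε n := by linarith [hεn n]
    have g1 : M.toSeminorm a ≤ D * ‖S‖ := by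
      have := (inv_mul_le_iff₀ hDn').mp hgen.1
      exact this.trans (mul_le_mul_of_nonneg_right hDn (norm_nonneg S))
    have g2 : ‖S‖ ≤ D * M.toSeminorm a := hgen.2.trans (mul_le_mul_of_nonneg_right hDn hMa)
    have hl2 : l2 a ≤ latticeNorm e z a := TensorNorm.l2_le _ a
    constructor
    · have h1 : ‖S‖ ≤ 4 * latticeNorm e z a := by
        refine (pi_norm_le_iff_of_nonneg (by linarith [l2.nonneg a])).mpr fun i => ?_
        by_cases hi : i ∈ T
        · have h2 := latticeNorm_mono e (hlub.1 ⟨i, hi, rfl⟩) a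
          linarith [(hk' i).1]
        · linarith [(hk' i).2.1 hi, l2.nonneg a]
      rw [mul_assoc]
      exact g1.trans (mul_le_mul_of_nonneg_left h1 hD.le)
    · have hSpos := norm_nonneg S
      have h1 : latticeNorm e z a ≤ (m + 1) * (B * ‖S‖) := by
        refine latticeNorm_le_of_isLUB e hlub ?_ fun i hi => ?_
        · refine ((hk' i₀).2.2.2 hi₀).trans ?_
          have := norm_le_pi_norm S i₀
          exact mul_le_mul hB this (norm_nonneg _) (by linarith)
        · have h2 := ((hk' i).2.2.1 hi).trans (norm_le_pi_norm S i)
          rw [← le_inv_mul_iff₀ (hc i)] at h2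
          exact h2.trans (mul_le_mul_of_nonneg_right (hcB i) hSpos)
      refine h1.trans ?_
      rw [mul_assoc, mul_assoc]
      exact mul_le_mul_of_nonneg_left (mul_le_mul_of_nonneg_left g2 (by linarith)) (by positivity)
  have key' : ∀ a : ℕ →₀ ℝ, M.toSeminorm a ≤ D * 4 * latticeNorm e z a ∧
      latticeNorm e z a ≤ (m + 1) * (B * D) * M.toSeminorm a := by
    intro a
    set r := 1 + l2 a
    have hr : 0 < r := by linarith [l2.nonneg a]
    have ha : ∀ j, |(r⁻¹ • a) j| ≤ 1 := by
      intro j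
      rw [Finsupp.smul_apply, smul_eq_mul, abs_mul, abs_inv, abs_of_pos hr, inv_mul_le_iff₀ hr,
        mul_one]
      have h1 := l2.abs_le_restr a (Finset.mem_singleton_self j)
      have h2 : l2 (restr a {j}) ≤ l2 a := l2.mono fun p => by
        rw [restr_apply]
        split_ifs <;> simp
      linarith
    obtain ⟨h1, h2⟩ := key _ ha
    have hri : 0 < r⁻¹ := inv_pos.mpr hr
    have s1 : M.toSeminorm (r⁻¹ • a) = r⁻¹ * M.toSeminorm a := by
      rw [map_smul_eq_mul, Real.norm_of_nonneg hri.le]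
    rw [s1, TensorNorm.smul_eq, abs_of_pos hri, mul_left_comm] at h1 h2
    exact ⟨le_of_mul_le_mul_left h1 hri, le_of_mul_le_mul_left h2 hri⟩
  have hu := (latticeNorm e z).unit_pos
  refine ⟨z, ⟨D * 4 * (latticeNorm e z).unit, fun a => ?_⟩,
    ⟨(latticeNorm e z).unit⁻¹ * ((m + 1) * (B * D)), fun a => ?_⟩⟩
  · change _ ≤ _ * ((latticeNorm e z).unit⁻¹ * latticeNorm e z a)
    rw [mul_assoc, mul_inv_cancel_left₀ hu.ne']
    exact (key' a).1
  · change (latticeNorm e z).unit⁻¹ * latticeNorm e z a ≤ _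
    rw [mul_assoc]
    exact mul_le_mul_of_nonneg_left (key' a).2 (inv_pos.mpr hu).le

theorem unitModel_le_iff [Preorder L] (i j : Fin m) :
    unitModel (latticeNorm e) i ≤ unitModel (latticeNorm e) j ↔ e i ≤ e j := by
  have hi := (latticeNorm e i).unit_pos
  have hj := (latticeNorm e j).unit_pos
  constructor
  · rintro ⟨C, hC⟩
    by_contra hij
    refine not_latticeNorm_le_mul e hij
      ((latticeNorm e i).unit * (C * (latticeNorm e j).unit⁻¹)) fun c => ?_
    have := hC c
    change (latticeNorm e i).unit⁻¹ * latticeNorm e i c ≤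
      C * ((latticeNorm e j).unit⁻¹ * latticeNorm e j c) at this
    rw [inv_mul_le_iff₀ hi] at this
    linarith
  · intro h
    refine ⟨(latticeNorm e i).unit⁻¹ * (latticeNorm e j).unit, fun c => ?_⟩
    change (latticeNorm e i).unit⁻¹ * latticeNorm e i c ≤
      _ * ((latticeNorm e j).unit⁻¹ * latticeNorm e j c)
    rw [mul_assoc, mul_inv_cancel_left₀ hj.ne']
    exact mul_le_mul_of_nonneg_left (latticeNorm_mono e h c) (inv_pos.mpr hi).le

end

theorem IsBasicSequence.linearIndependent {X : Type*} [NormedAddCommGroup X] [NormedSpace ℝ X]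
    {x : ℕ → X} (hx : IsBasicSequence x) : LinearIndependent ℝ x := by
  obtain ⟨b, hb⟩ := hx
  have h := b.linearIndependent.map' (Submodule.subtype _) (Submodule.ker_subtype _)
  rwa [show ⇑(Submodule.subtype _) ∘ b.basis = x from funext hb] at h

theorem mainTheorem4 (L : Type*) [Lattice L] [Finite L] [Nonempty L] :
    ∃ (X : Type) (_ : NormedAddCommGroup X) (_ : NormedSpace ℝ X),
      CompleteSpace X ∧ TopologicalSpace.SeparableSpace X ∧ ¬ FiniteDimensional ℝ X ∧
        IsReflexiveSpace X ∧ Nonempty (SPw X ≃o L) := by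
  let e : Fin (Nat.card L) ≃ L := (Finite.equivFin L).symm
  let N := latticeNorm e
  refine ⟨∀ i, (N i).Space, inferInstance, inferInstance, inferInstance, inferInstance,
    fun hfin => ?_, isReflexiveSpace_pi fun i => Space.isReflexiveSpace (N i), ⟨?_⟩⟩
  · let z := e.symm (Classical.arbitrary L)
    exact Module.Finite.not_linearIndependent_of_infinite _
      (isBasicSequence_unitVec N z).linearIndependent
  · let g : L ↪o SPw (∀ i, (N i).Space) := OrderEmbedding.ofMapLEIff
      (fun ℓ => toAntisymmetrization (· ≤ ·) (unitModel N (e.symm ℓ))) fun a b => by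
        rw [toAntisymmetrization_le_toAntisymmetrization_iff, unitModel_le_iff]
        simp
    refine (RelIso.ofSurjective g fun M => ?_).symm
    induction M using Antisymmetrization.ind with
    | _ M =>
      obtain ⟨z, h1, h2⟩ := exists_equiv_unitModel e e.surjective M
      refine ⟨e z, Quotient.sound ⟨?_, ?_⟩⟩
      · simpa using h2
      · simpa using h1
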